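/- Let $N\ge 1$, $r\ge 1$, $d_1,\dots,d_N\ge 1$, let $\lambda_1>\lambda_2>\cdots>\lambda_r>0$, let $a_{jk}\in\mathbb{R}^{d_k}$ be (deterministic) vectors with $\|a_{jk}\|_2=1$ ($1\le j\le r$, $1\le k\le N$), and let $$T=\sum_{j=1}^r\lambda_j\, a_{j1}\otimes a_{j2}\otimes\cdots\otimes a_{jN}+\Psi\in\mathbb{R}^{d_1\times\cdots\times d_N},$$ where the entries of $\Psi$ are i.i.d. $N(0,\sigma^2)$, $\sigma\ge 0$. Let $S\subseteq\{1,\dots,N\}$, $S^c=\{1,\dots,N\}\setminus S$, $d=\prod_{k=1}^N d_k$, $d_S=\prod_{k\in S}d_k$, and let $\mathrm{mat}_S(T)\in\mathbb{R}^{d_S\times(d/d_S)}$ be the unfolding of $T$ with rows indexed by the modes in $S$ and columns by the modes in $S^c$. Let $A_S$ be the $d_S\times r$ matrix with columns $\mathrm{vec}(\otimes_{k\in S}a_{jk})$, let $A_{S^c}$ be the $(d/d_S)\times r$ matrix with columns $\mathrm{vec}(\otimes_{k\in S^c}a_{jk})$, and put $$\delta=\max\big\{\|A_S^\top A_S-I_r\|_{\rm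 S},\ \|A_{S^c}^\top A_{S^c}-I_r\|_{\rm S}\big\},\qquad \lambda_{j,\pm}=\min(\lambda_{j-1}-\lambda_j,\ \lambda_j-\lambda_{j+1}),$$ with $\lambda_0=2\lambda_1$, $\lambda_{r+1}=0$ and $\|\cdot\|_{\rm S}$ the spectral norm. Composite PCA (CPCA) with unfolding $S$ takes the top $r$ components $(\hat\lambda_j,\hat u_j,\hat v_j)$, $1\le j\le r\le \min(d_S,d/d_S)$, of a singular value decomposition $\mathrm{mat}_S(T)=\sum_j\hat\lambda_j\hat u_j\hat v_j^\top$ (singular values in non-increasing order) and lets $\hat a_{jk}$ be a top left singular vector (of unit length) of the mode-$k$ unfolding of $\hat u_j$, viewed as a tensor with modes $S$, if $k\in S$, and of $\hat v_j$, viewed as a tensor with modes $S^c$, if $k\in S^c$. Then there is an event of probability at least $1-e^{-2d_S-2d/d_S}$ on which every output of CPCA (whatever choices are made for ties and signs in the singular value decompositions) satisfies, for all $1\le j\le r$ and $1\le k\le N$, $$\big\|\hat a_{jk}\hat a_{jk}^\top-a_{jk}a_{jk}^\top\big\|_{\rm S}\ \le\ \Big(1+\frac{2\sqrt2\,\lambda_1}{\lambda_{j,\pm}}\Big)\delta+\frac{6\sigma\big(\sqrt{d_S}+\sqrt{d/d_S}\big)}{\lambda_{j,\pm}}.$$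 (The left-hand side is the absolute sine of the angle between $\hat a_{jk}$ and $a_{jk}$.) -/

import Mathlib

open MeasureTheory ProbabilityTheory
open scoped NNReal

namespace CPModel

/-- Multi-indices of a tensor with modes `ι` and dimensions `d k`, `k : ι`. A real tensor is a
function on them, and `vec` is the identification of a tensor with a vector indexed by `Idx d`. -/
abbrev Idx {ι : Type} (d : ι → ℕ) : Type := ∀ k : ι, Fin (d k)

/-- Multi-indices over the modes in `S`. -/
abbrev IdxIn {N : ℕ} (d : Fin N → ℕ) (S : Finset (Fin N)) : Type :=
  Idx (fun k : {k : Fin N // k ∈ S} => d k)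

/-- Multi-indices over the modes outside `S`. -/
abbrev IdxOut {N : ℕ} (d : Fin N → ℕ) (S : Finset (Fin N)) : Type :=
  Idx (fun k : {k : Fin N // k ∉ S} => d k)

section Matrices

open scoped Matrix.Norms.L2Operator

variable {m n : Type} [Fintype m] [Fintype n] [DecidableEq m] [DecidableEq n]

/-- The spectral norm, i.e. the operator norm with respect to the Euclidean norms. -/
noncomputable def specNorm (M : Matrix m n ℝ) : ℝ := ‖M‖

/-- The rank-one matrix `x yᵀ`. -/
def outer (x : EuclideanSpace ℝ m) (y : EuclideanSpace ℝ n) : Matrix m n ℝ :=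
  Matrix.vecMulVec x.ofLp y.ofLp

/-- `M = ∑ i, s i • u i (v i)ᵀ` is a (reduced) singular value decomposition, with the singular
values in non-increasing order. -/
structure IsSVD (M : Matrix m n ℝ)
    (s : Fin (min (Fintype.card m) (Fintype.card n)) → ℝ)
    (u : Fin (min (Fintype.card m) (Fintype.card n)) → EuclideanSpace ℝ m)
    (v : Fin (min (Fintype.card m) (Fintype.card n)) → EuclideanSpace ℝ n) : Prop where
  nonneg : ∀ i, 0 ≤ s i
  antitone : Antitone s
  orthonormal_left : Orthonormal ℝ u
  orthonormal_right : Orthonormal ℝ v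
  eq_sum : M = ∑ i, s i • outer (u i) (v i)

/-- `x` is a top left singular vector of `M`: a unit vector which, together with some unit vector
`y`, is a singular pair for the largest singular value `‖M‖` of `M`. -/
def IsTopLeftSingularVector (M : Matrix m n ℝ) (x : EuclideanSpace ℝ m) : Prop :=
  ‖x‖ = 1 ∧ ∃ y : EuclideanSpace ℝ n, ‖y‖ = 1 ∧
    M.mulVec y.ofLp = specNorm M • x.ofLp ∧ M.transpose.mulVec x.ofLp = specNorm M • y.ofLp

end Matrices

/-- The mode-`k` unfolding of a tensor, a `d k × (∏ l ≠ k, d l)` matrix. -/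
def modeUnfold {ι : Type} [DecidableEq ι] {d : ι → ℕ} (k : ι) (A : Idx d → ℝ) :
    Matrix (Fin (d k)) (Idx (fun l : {l : ι // l ≠ k} => d l)) ℝ :=
  fun i y => A ((Equiv.piSplitAt k (fun l => Fin (d l))).symm (i, y))

/-- The unfolding `mat_S` of a tensor: rows are indexed by the modes in `S`, columns by the modes
outside `S`. -/
def matUnfold {N : ℕ} {d : Fin N → ℕ} (S : Finset (Fin N)) (T : Idx d → ℝ) :
    Matrix (IdxIn d S) (IdxOut d S) ℝ :=
  fun x y => T ((Equiv.piEquivPiSubtypeProd (fun k => k ∈ S) (fun k => Fin (d k))).symm (x, y))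

section Model

variable {N r : ℕ} {d : Fin N → ℕ}

/-- The low-rank signal `∑ j, λ_j ⊗_k a_{jk}`. -/
def signal (lam : Fin r → ℝ) (a : Fin r → ∀ k : Fin N, EuclideanSpace ℝ (Fin (d k))) :
    Idx d → ℝ :=
  fun x => ∑ j, lam j * ∏ k, a j k (x k)

/-- The matrix `A_S` with columns `vec (⊗_{k ∈ S} a_{jk})`. -/
def basisIn (a : Fin r → ∀ k : Fin N, EuclideanSpace ℝ (Fin (d k))) (S : Finset (Fin N)) :
    Matrix (IdxIn d S) (Fin r) ℝ :=
  fun x j => ∏ k : {k : Fin N // k ∈ S}, a j k (x k)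

/-- The matrix `A_{Sᶜ}` with columns `vec (⊗_{k ∉ S} a_{jk})`. -/
def basisOut (a : Fin r → ∀ k : Fin N, EuclideanSpace ℝ (Fin (d k))) (S : Finset (Fin N)) :
    Matrix (IdxOut d S) (Fin r) ℝ :=
  fun x j => ∏ k : {k : Fin N // k ∉ S}, a j k (x k)

/-- `δ = ‖A_Sᵀ A_S - I‖ ∨ ‖A_{Sᶜ}ᵀ A_{Sᶜ} - I‖`. -/
noncomputable def coherence (a : Fin r → ∀ k : Fin N, EuclideanSpace ℝ (Fin (d k)))
    (S : Finset (Fin N)) : ℝ :=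
  max (specNorm ((basisIn a S).transpose * basisIn a S - 1))
    (specNorm ((basisOut a S).transpose * basisOut a S - 1))

/-- The values `λ_0 = 2 λ_1`, `λ_1, …, λ_r`, and `λ_i = 0` for `i > r`; here `λ_{i+1}` is
`lam ⟨i, _⟩`. -/
def extLam [NeZero r] (lam : Fin r → ℝ) : ℕ → ℝ
  | 0 => 2 * lam 0
  | i + 1 => if h : i < r then lam ⟨i, h⟩ else 0

/-- The eigengap `λ_{j,±} = min (λ_{j-1} - λ_j) (λ_j - λ_{j+1})`; the position of `j : Fin r` in
the sequence `extLam lam` is `j + 1`. -/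
noncomputable def eigengap [NeZero r] (lam : Fin r → ℝ) (j : Fin r) : ℝ :=
  min (extLam lam j - extLam lam (j + 1)) (extLam lam (j + 1) - extLam lam (j + 2))

/-- `(lamHat, aHat)` is an output of composite PCA applied to the tensor `T` with rank `r` through
the unfolding `mat_S`: for some singular value decomposition of `mat_S T`, with top `r` components
`(lamHat j, u j, v j)`, each `aHat j k` is a top left singular vector of the mode-`k` unfolding of
`u j` (if `k ∈ S`) or of `v j` (if `k ∉ S`). All choices left open by ties and signs are
allowed. -/
def IsCPCAOutput (T : Idx d → ℝ) (S : Finset (Fin N)) (lamHat : Fin r → ℝ)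
    (aHat : Fin r → ∀ k : Fin N, EuclideanSpace ℝ (Fin (d k))) : Prop :=
  ∃ (hr : r ≤ min (Fintype.card (IdxIn d S)) (Fintype.card (IdxOut d S)))
    (s : Fin (min (Fintype.card (IdxIn d S)) (Fintype.card (IdxOut d S))) → ℝ)
    (u : Fin (min (Fintype.card (IdxIn d S)) (Fintype.card (IdxOut d S))) →
      EuclideanSpace ℝ (IdxIn d S))
    (v : Fin (min (Fintype.card (IdxIn d S)) (Fintype.card (IdxOut d S))) →
      EuclideanSpace ℝ (IdxOut d S)),
    IsSVD (matUnfold S T) s u v ∧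
    ∀ j : Fin r,
      lamHat j = s (Fin.castLE hr j) ∧
      (∀ (k : Fin N) (hk : k ∈ S),
        IsTopLeftSingularVector
          (modeUnfold (⟨k, hk⟩ : {k : Fin N // k ∈ S}) (u (Fin.castLE hr j)).ofLp) (aHat j k)) ∧
      (∀ (k : Fin N) (hk : k ∉ S),
        IsTopLeftSingularVector
          (modeUnfold (⟨k, hk⟩ : {k : Fin N // k ∉ S}) (v (Fin.castLE hr j)).ofLp) (aHat j k))

end Model

end CPModel

set_option linter.unusedSectionVars false

/-! The unfolded signal is `A diag(lam) Bᵀ`, where `A` and `B` have almost orthonormal columns.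
Replacing them by their polar factors `U`, `V` (`exists_orthonormal_columns_near`) gives an exact
singular value decomposition `U diag(lam) Vᵀ`. The unfolded tensor differs from it by at most `e =
λ₁ η (2 + η) + ψ`, where `η` is of order `δ / 2` and `ψ` bounds the noise.

If `2e` is below the eigengap `γ`, Weyl's inequality (`singularValue_le_add`) matches the j-th
singular values, and `sq_gap_mul_sin_sq_le` bounds the sine between the j-th singular vectors by `√2
e / γ`. Adding the distance `η` from `U` back to `A` gives a squared sine of at most `R² / 2`
whenever the claimed bound `R` is below 1 (`one_sub_sq_inner_colVec_le`).

The squared correlation with the rank-one tensor then exceeds 1/2. In that regime a top singular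
vector of a mode unfolding is at least as close to its factor as the whole tensor is to the rank-one
tensor (`sq_inner_le_of_isTopLeftSingularVector`), so passing to the factors loses nothing. For `R ≥
1` there is nothing to prove, since a sine is at most 1.

The only probabilistic input is `exists_event_specNorm_le`, with `ψ = 3σ(√d_S + √(d/d_S))`. Its
proof replaces the usual net by an average over the unit ball: a large spectral norm makes
`exp(c‖Xg‖²)` large on a small ball of vectors `g`, while its expectation is at most `2 ^ m` for
every `g` in the unit ball. -/

namespace CPModel

/-! ### Spectral norm and rank-one matrices -/

section Matrices

open scoped Matrix.Norms.L2Operator RealInnerProductSpace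
open Matrix WithLp

variable {m n : Type} [Fintype m] [Fintype n] [DecidableEq m] [DecidableEq n]

lemma norm_toLp_mulVec_le (M : Matrix m n ℝ) (x : EuclideanSpace ℝ n) :
    ‖toLp 2 (M *ᵥ x.ofLp)‖ ≤ specNorm M * ‖x‖ :=
  Matrix.l2_opNorm_mulVec M x

lemma specNorm_nonneg (M : Matrix m n ℝ) : 0 ≤ specNorm M := norm_nonneg _

lemma specNorm_le_of_forall (M : Matrix m n ℝ) {c : ℝ} (hc : 0 ≤ c)
    (h : ∀ x : EuclideanSpace ℝ n, ‖toLp 2 (M *ᵥ x.ofLp)‖ ≤ c * ‖x‖) : specNorm M ≤ c := by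
  unfold specNorm
  rw [Matrix.l2_opNorm_def]
  exact ContinuousLinearMap.opNorm_le_bound _ hc h

lemma specNorm_transpose (M : Matrix m n ℝ) : specNorm Mᵀ = specNorm M := by
  unfold specNorm
  rw [← Matrix.conjTranspose_eq_transpose_of_trivial, Matrix.l2_opNorm_conjTranspose]

lemma specNorm_add_le (M M' : Matrix m n ℝ) : specNorm (M + M') ≤ specNorm M + specNorm M' :=
  norm_add_le M M'

lemma outer_mulVec (x : EuclideanSpace ℝ m) (y z : EuclideanSpace ℝ n) :
    toLp 2 (outer x y *ᵥ z.ofLp) = ⟪y, z⟫ • x := by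
  ext i
  simp [outer, Matrix.vecMulVec_mulVec, PiLp.inner_apply, dotProduct, mul_comm]

lemma inner_toLp_mulVec (M : Matrix m n ℝ) (x : EuclideanSpace ℝ m) (y : EuclideanSpace ℝ n) :
    ⟪x, toLp 2 (M *ᵥ y.ofLp)⟫ = ∑ i, ∑ j, M i j * (x i * y j) := by
  simp only [PiLp.inner_apply, mulVec, dotProduct, RCLike.inner_apply, conj_trivial,
    Finset.sum_mul]
  refine Finset.sum_congr rfl fun i _ => Finset.sum_congr rfl fun j _ => by ring

lemma inner_toLp_transpose_mulVec (M : Matrix m n ℝ) (x : EuclideanSpace ℝ m)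
    (y : EuclideanSpace ℝ n) :
    ⟪toLp 2 (Mᵀ *ᵥ x.ofLp), y⟫ = ⟪x, toLp 2 (M *ᵥ y.ofLp)⟫ := by
  rw [real_inner_comm, inner_toLp_mulVec, inner_toLp_mulVec, Finset.sum_comm]
  refine Finset.sum_congr rfl fun i _ => Finset.sum_congr rfl fun j _ => by
    simp [mul_comm]

end Matrices

/-! ### Projections onto lines -/

section InnerProductSpace

open scoped RealInnerProductSpace

variable {E : Type*} [NormedAddCommGroup E] [InnerProductSpace ℝ E]

lemma inner_self_sub_smul {x : E} (hx : ‖x‖ = 1) (y : E) : ⟪x, y - ⟪x, y⟫ • x⟫ = 0 := by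
  rw [inner_sub_right, inner_smul_right, real_inner_self_eq_norm_sq, hx]; ring

lemma norm_sub_inner_smul_sq {x : E} (hx : ‖x‖ = 1) (y : E) :
    ‖y - ⟪x, y⟫ • x‖ ^ 2 = ‖y‖ ^ 2 - ⟪x, y⟫ ^ 2 := by
  rw [@norm_sub_sq_real, inner_smul_right, norm_smul, hx, real_inner_comm]
  rw [mul_one, Real.norm_eq_abs, sq_abs]; ring

/-- The difference of two line projections vanishes off their common plane and scales lengths by the
sine of the angle on it. The inequality is Cauchy–Schwarz for the parts of `y` and `z` orthogonal to
`x`. -/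
lemma norm_inner_smul_sub_inner_smul_sq_le {x y : E} (hx : ‖x‖ = 1) (hy : ‖y‖ = 1) (z : E) :
    ‖⟪x, z⟫ • x - ⟪y, z⟫ • y‖ ^ 2 ≤ (1 - ⟪x, y⟫ ^ 2) * ‖z‖ ^ 2 := by
  set w := y - ⟪x, y⟫ • x with hw
  have h1 : ‖w‖ ^ 2 = 1 - ⟪x, y⟫ ^ 2 := by rw [hw, norm_sub_inner_smul_sq hx, hy]; ring
  have h2 : ⟪y, z⟫ = ⟪x, y⟫ * ⟪x, z⟫ + ⟪w, z - ⟪x, z⟫ • x⟫ := by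
    rw [inner_sub_right, inner_smul_right, real_inner_comm x w, hw, inner_self_sub_smul hx]
    rw [inner_sub_left, inner_smul_left]; simp
  have h3 : ⟪w, z - ⟪x, z⟫ • x⟫ ^ 2 ≤ (1 - ⟪x, y⟫ ^ 2) * (‖z‖ ^ 2 - ⟪x, z⟫ ^ 2) := by
    rw [← h1, ← norm_sub_inner_smul_sq hx, ← mul_pow, ← sq_abs]
    exact pow_le_pow_left₀ (abs_nonneg _) (abs_real_inner_le_norm _ _) 2
  have h4 : ‖⟪x, z⟫ • x - ⟪y, z⟫ • y‖ ^ 2 =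
      ⟪x, z⟫ ^ 2 + ⟪y, z⟫ ^ 2 - 2 * ⟪x, y⟫ * ⟪x, z⟫ * ⟪y, z⟫ := by
    rw [@norm_sub_sq_real, inner_smul_right, inner_smul_left, norm_smul, norm_smul, hx, hy]
    simp only [mul_one, Real.norm_eq_abs, sq_abs, conj_trivial]; ring
  rw [h4]
  set β := ⟪w, z - ⟪x, z⟫ • x⟫
  rw [h2]
  nlinarith

end InnerProductSpace

/-! ### Top singular vector of a nearly rank-one matrix -/

section TopSingularVector

open scoped Matrix.Norms.L2Operator RealInnerProductSpace
open Matrix WithLp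

variable {m n : Type} [Fintype m] [Fintype n] [DecidableEq m] [DecidableEq n]

lemma specNorm_outer_sub_outer_le {x y : EuclideanSpace ℝ m} (hx : ‖x‖ = 1) (hy : ‖y‖ = 1) :
    specNorm (outer x x - outer y y) ≤ √(1 - ⟪x, y⟫ ^ 2) := by
  refine specNorm_le_of_forall _ (Real.sqrt_nonneg _) fun z => ?_
  rw [sub_mulVec, toLp_sub, outer_mulVec, outer_mulVec,
    ← Real.sqrt_sq (norm_nonneg z), ← Real.sqrt_mul' _ (sq_nonneg _)]
  exact Real.le_sqrt_of_sq_le (norm_inner_smul_sub_inner_smul_sq_le hx hy z)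

/-- Here `c`, `b` are the correlations of the test vectors with the top singular pair, `s` is the
top singular value and `β` the contribution of the orthogonal parts. Cauchy–Schwarz gives `(cbs +
β)² ≤ c²s² + (1 - c²)τ` for `τ = s²` and `τ = 1 - s²`. If `c² ≥ 1/2`, the second choice gives at
most `c²`; if `c² < 1/2`, one of the two gives at most 1/2, contradicting `hp`. -/
lemma sq_le_of_orthogonal_split {c b s β : ℝ}
    (hc : c ^ 2 ≤ 1) (hb : b ^ 2 ≤ 1)
    (h1 : β ^ 2 ≤ s ^ 2 * ((1 - c ^ 2) * (1 - b ^ 2)))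
    (h2 : β ^ 2 ≤ (1 - s ^ 2) * ((1 - c ^ 2) * (1 - b ^ 2)))
    (hs1 : s ^ 2 ≤ 1)
    (hp : 1 / 2 < (c * b * s + β) ^ 2) : (c * b * s + β) ^ 2 ≤ c ^ 2 := by
  have key : ∀ τ : ℝ, 0 ≤ τ → β ^ 2 ≤ τ * ((1 - c ^ 2) * (1 - b ^ 2)) →
      (c * b * s + β) ^ 2 ≤ c ^ 2 * s ^ 2 + (1 - c ^ 2) * τ := by
    intro τ hτ hβ
    set t := (1 - c ^ 2) * τ with ht
    have ht0 : 0 ≤ t := mul_nonneg (by linarith) hτ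
    have hβ' : β ^ 2 ≤ t * (1 - b ^ 2) := by rw [ht]; linarith
    have hnn : 0 ≤ (c * s) ^ 2 * (1 - b ^ 2) + t * b ^ 2 :=
      add_nonneg (mul_nonneg (sq_nonneg _) (by linarith)) (by positivity)
    have h3 : (2 * (c * s * b * β)) ^ 2 ≤ ((c * s) ^ 2 * (1 - b ^ 2) + t * b ^ 2) ^ 2 := by
      have : (c * s * b) ^ 2 * β ^ 2 ≤ (c * s * b) ^ 2 * (t * (1 - b ^ 2)) :=
        mul_le_mul_of_nonneg_left hβ' (sq_nonneg _)
      nlinarith [sq_nonneg ((c * s) ^ 2 * (1 - b ^ 2) - t * b ^ 2)]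
    have h4 := (abs_le_of_sq_le_sq' h3 hnn).2
    nlinarith
  have k1 := key _ (sq_nonneg s) h1
  have k2 := key _ (by linarith) h2
  rcases le_or_gt (1 / 2) (c ^ 2) with h | h
  · nlinarith
  · rcases le_total (s ^ 2) (1 / 2) with h' | h' <;> nlinarith

/-- If a matrix of unit Frobenius norm is strictly more than half explained by a rank one matrix
`a bᵀ`, then its top left singular vector is at least as close to `a`. -/
lemma sq_inner_le_of_isTopLeftSingularVector {M : Matrix m n ℝ} {x a : EuclideanSpace ℝ m}
    {b : EuclideanSpace ℝ n} (hM : ∑ i, ∑ j, M i j ^ 2 = 1) (ha : ‖a‖ = 1) (hb : ‖b‖ = 1)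
    (hx : IsTopLeftSingularVector M x)
    (hp : 1 / 2 < ⟪a, toLp 2 (M *ᵥ b.ofLp)⟫ ^ 2) :
    ⟪a, toLp 2 (M *ᵥ b.ofLp)⟫ ^ 2 ≤ ⟪x, a⟫ ^ 2 := by
  obtain ⟨hx1, y, hy1, hMy, hMx⟩ := hx
  set s := specNorm M
  set w := a - ⟪x, a⟫ • x with hw
  set z := b - ⟪y, b⟫ • y with hz
  have hxw : ⟪x, w⟫ = 0 := inner_self_sub_smul hx1 a
  have hyz : ⟪y, z⟫ = 0 := inner_self_sub_smul hy1 b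
  have hw2 : ‖w‖ ^ 2 = 1 - ⟪x, a⟫ ^ 2 := by rw [hw, norm_sub_inner_smul_sq hx1, ha]; ring
  have hz2 : ‖z‖ ^ 2 = 1 - ⟪y, b⟫ ^ 2 := by rw [hz, norm_sub_inner_smul_sq hy1, hb]; ring
  have hB : ∀ u v, ⟪u, toLp 2 (M *ᵥ (ofLp (v : EuclideanSpace ℝ n)))⟫
      = ⟪toLp 2 (Mᵀ *ᵥ u.ofLp), v⟫ := fun u v => (inner_toLp_transpose_mulVec M u v).symm
  have hMx' : toLp 2 (Mᵀ *ᵥ x.ofLp) = s • y := by rw [hMx]; rfl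
  have hMy' : toLp 2 (M *ᵥ y.ofLp) = s • x := by rw [hMy]; rfl
  set β := ⟪w, toLp 2 (M *ᵥ z.ofLp)⟫ with hβ
  have hexp : ⟪a, toLp 2 (M *ᵥ b.ofLp)⟫ = ⟪x, a⟫ * ⟪y, b⟫ * s + β := by
    have hbz : b.ofLp = z.ofLp + ⟪y, b⟫ • y.ofLp := by
      rw [hz]; simp
    have e1 : ⟪a, toLp 2 (M *ᵥ b.ofLp)⟫ = ⟪x, a⟫ * ⟪x, toLp 2 (M *ᵥ b.ofLp)⟫
        + ⟪w, toLp 2 (M *ᵥ b.ofLp)⟫ := by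
      rw [hw, inner_sub_left, inner_smul_left]; simp
    have e2 : ⟪w, toLp 2 (M *ᵥ b.ofLp)⟫ = β := by
      rw [hbz, mulVec_add, mulVec_smul, toLp_add, toLp_smul, hMy', inner_add_right,
        inner_smul_right, inner_smul_right, real_inner_comm, real_inner_comm x w, hxw]
      simp [hβ, real_inner_comm]
    rw [e1, e2, hB, hMx', inner_smul_left]; simp; ring
  -- The remainder is bounded twice: here by the operator norm `s`, and in `h2` by the Frobenius
  -- norm of `M - s x yᵀ`, whose square is `1 - s²`.
  have h1 : β ^ 2 ≤ s ^ 2 * ((1 - ⟪x, a⟫ ^ 2) * (1 - ⟪y, b⟫ ^ 2)) := by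
    have : |β| ≤ ‖w‖ * (s * ‖z‖) := (abs_real_inner_le_norm _ _).trans
      (mul_le_mul_of_nonneg_left (norm_toLp_mulVec_le M z) (norm_nonneg _))
    calc β ^ 2 = |β| ^ 2 := (sq_abs _).symm
      _ ≤ (‖w‖ * (s * ‖z‖)) ^ 2 := pow_le_pow_left₀ (abs_nonneg _) this 2
      _ = _ := by rw [← hw2, ← hz2]; ring
  have hsxy : ⟪x, toLp 2 (M *ᵥ y.ofLp)⟫ = s := by
    rw [hMy', inner_smul_right, real_inner_self_eq_norm_sq, hx1]; ring
  have hxs : ∑ i, x i ^ 2 = 1 := by rw [← EuclideanSpace.real_norm_sq_eq, hx1]; ring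
  have hys : ∑ i, y i ^ 2 = 1 := by rw [← EuclideanSpace.real_norm_sq_eq, hy1]; ring
  have hres : ∑ q : m × n, (M q.1 q.2 - s * (x q.1 * y q.2)) ^ 2 = 1 - s ^ 2 := by
    have e0 : ∀ q : m × n, (M q.1 q.2 - s * (x q.1 * y q.2)) ^ 2 = M q.1 q.2 ^ 2
        - 2 * s * (M q.1 q.2 * (x q.1 * y q.2)) + s ^ 2 * (x q.1 ^ 2 * y q.2 ^ 2) :=
      fun q => by ring
    simp only [e0, Finset.sum_add_distrib, Finset.sum_sub_distrib, ← Finset.mul_sum]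
    rw [inner_toLp_mulVec] at hsxy
    rw [Fintype.sum_prod_type, Fintype.sum_prod_type, Fintype.sum_prod_type, hM, hsxy]
    simp only [← Finset.mul_sum, hys, mul_one, hxs]; ring
  have h2 : β ^ 2 ≤ (1 - s ^ 2) * ((1 - ⟪x, a⟫ ^ 2) * (1 - ⟪y, b⟫ ^ 2)) := by
    have e1 : β = ∑ q : m × n, (M q.1 q.2 - s * (x q.1 * y q.2)) * (w q.1 * z q.2) := by
      have e0 : ∀ q : m × n, (M q.1 q.2 - s * (x q.1 * y q.2)) * (w q.1 * z q.2) =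
        M q.1 q.2 * (w q.1 * z q.2) - s * ((x q.1 * w q.1) * (y q.2 * z q.2)) :=
        fun q => by ring
      simp only [e0, Finset.sum_sub_distrib, ← Finset.mul_sum]
      rw [Fintype.sum_prod_type, Fintype.sum_prod_type, hβ, inner_toLp_mulVec]
      have : ∑ i, y i * z i = 0 := by
        rw [← hyz]; simp [PiLp.inner_apply, mul_comm]
      simp [← Finset.mul_sum, this]
    have e2 : ∑ q : m × n, (w q.1 * z q.2) ^ 2 = ‖w‖ ^ 2 * ‖z‖ ^ 2 := by
      rw [EuclideanSpace.real_norm_sq_eq, EuclideanSpace.real_norm_sq_eq,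
        Fintype.sum_prod_type, Finset.sum_mul_sum]
      simp [mul_pow]
    rw [e1, ← hw2, ← hz2, ← e2, ← hres]
    exact Finset.sum_mul_sq_le_sq_mul_sq _ _ _
  have hs1 : s ^ 2 ≤ 1 := by
    have : 0 ≤ 1 - s ^ 2 := hres ▸ Finset.sum_nonneg fun _ _ => sq_nonneg _
    linarith
  rw [hexp] at hp ⊢
  exact sq_le_of_orthogonal_split (by nlinarith [sq_nonneg ‖w‖]) (by nlinarith [sq_nonneg ‖z‖])
    h1 h2 hs1 hp

end TopSingularVector

/-! ### Rank-one tensors and mode unfoldings -/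

section Tensor

open scoped RealInnerProductSpace
open WithLp

variable {ι : Type} [Fintype ι] [DecidableEq ι] {d : ι → ℕ}

/-- The rank one tensor `⊗ k, a k`, as a Euclidean vector. -/
noncomputable def rankOne (a : ∀ k, EuclideanSpace ℝ (Fin (d k))) : EuclideanSpace ℝ (Idx d) :=
  toLp 2 fun x => ∏ k, a k (x k)

lemma norm_rankOne {a : ∀ k, EuclideanSpace ℝ (Fin (d k))} (ha : ∀ k, ‖a k‖ = 1) :
    ‖rankOne a‖ = 1 := by
  have : ‖rankOne a‖ ^ 2 = 1 := by
    rw [EuclideanSpace.real_norm_sq_eq]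
    simp only [rankOne, ← Finset.prod_pow]
    rw [← Fintype.prod_sum (fun k (i : Fin (d k)) => a k i ^ 2)]
    simp [← EuclideanSpace.real_norm_sq_eq, ha]
  exact (pow_eq_one_iff_of_nonneg (norm_nonneg _) two_ne_zero).1 this

lemma sum_modeUnfold (k : ι) (A : Idx d → ℝ) (g : Fin (d k) →
    Idx (fun l : {l : ι // l ≠ k} => d l) → ℝ → ℝ) :
    ∑ i, ∑ y, g i y (modeUnfold k A i y) =
      ∑ x, g (x k) (fun l => x l) (A x) := by
  rw [← Fintype.sum_prod_type (fun q : Fin (d k) × Idx (fun l : {l : ι // l ≠ k} => d l) =>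
    g q.1 q.2 (modeUnfold k A q.1 q.2))]
  refine (Fintype.sum_equiv (Equiv.piSplitAt k (fun l => Fin (d l))) _ _ fun x => ?_).symm
  simp only [modeUnfold]
  congr 1
  exact congrArg A ((Equiv.piSplitAt k (fun l => Fin (d l))).symm_apply_apply x).symm

/-- A top left singular vector of an unfolding of a unit tensor is at least as close to the factor
`a k` as the tensor is to the rank one tensor `⊗ k, a k`, if the latter are close. -/
lemma sq_inner_rankOne_le {u : EuclideanSpace ℝ (Idx d)} (hu : ‖u‖ = 1)
    {a : ∀ k, EuclideanSpace ℝ (Fin (d k))} (ha : ∀ k, ‖a k‖ = 1) (k : ι)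
    {x : EuclideanSpace ℝ (Fin (d k))}
    (hx : IsTopLeftSingularVector (modeUnfold k u.ofLp) x)
    (hp : 1 / 2 < ⟪u, rankOne a⟫ ^ 2) : ⟪u, rankOne a⟫ ^ 2 ≤ ⟪x, a k⟫ ^ 2 := by
  have e : ⟪u, rankOne a⟫ = ⟪a k, toLp 2 ((modeUnfold k u.ofLp).mulVec
      (rankOne fun l : {l : ι // l ≠ k} => a l).ofLp)⟫ := by
    rw [inner_toLp_mulVec, sum_modeUnfold k u.ofLp (fun i y t => t * (a k i * (rankOne
      fun l : {l : ι // l ≠ k} => a l) y))]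
    simp only [PiLp.inner_apply, rankOne, RCLike.inner_apply, conj_trivial]
    refine Finset.sum_congr rfl fun z _ => ?_
    rw [mul_comm, Fintype.prod_eq_mul_prod_subtype_ne _ k]
  have hM : ∑ i, ∑ y, modeUnfold k u.ofLp i y ^ 2 = 1 := by
    rw [sum_modeUnfold k u.ofLp (fun _ _ t => t ^ 2), ← EuclideanSpace.real_norm_sq_eq, hu]
    ring
  rw [e] at hp ⊢
  exact sq_inner_le_of_isTopLeftSingularVector hM (ha k)
    (norm_rankOne fun l : {l : ι // l ≠ k} => ha l) hx hp

end Tensor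

/-! ### Perturbation of singular values and vectors -/

section SVD

open scoped RealInnerProductSpace

variable {E F : Type*} [NormedAddCommGroup E] [InnerProductSpace ℝ E]
  [NormedAddCommGroup F] [InnerProductSpace ℝ F]

/-- The operator `∑ i, s i • u i ⟨v i, ·⟩`. -/
noncomputable def svdMap {ι : Type*} [Fintype ι] (s : ι → ℝ) (u : ι → E) (v : ι → F) (x : F) : E :=
  ∑ i, (s i * ⟪v i, x⟫) • u i

lemma norm_sq_sum_smul {ι : Type*} [Fintype ι] {u : ι → E} (hu : Orthonormal ℝ u) (c : ι → ℝ) :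
    ‖∑ i, c i • u i‖ ^ 2 = ∑ i, c i ^ 2 := by
  rw [← real_inner_self_eq_norm_sq, hu.inner_sum]
  simp [sq]

lemma norm_sq_svdMap {ι : Type*} [Fintype ι] {u : ι → E} (hu : Orthonormal ℝ u) (s : ι → ℝ)
    (v : ι → F) (x : F) : ‖svdMap s u v x‖ ^ 2 = ∑ i, (s i * ⟪v i, x⟫) ^ 2 :=
  norm_sq_sum_smul hu _

lemma inner_svdMap {ι : Type*} [Fintype ι] (s : ι → ℝ) (u : ι → E) (v : ι → F) (x : F) (y : E) :
    ⟪svdMap s u v x, y⟫ = ∑ i, s i * ⟪u i, y⟫ * ⟪v i, x⟫ := by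
  simp only [svdMap, sum_inner, inner_smul_left, conj_trivial]
  exact Finset.sum_congr rfl fun i _ => by ring

lemma svdMap_apply_right {ι : Type*} [Fintype ι] {v : ι → F} (hv : Orthonormal ℝ v)
    (s : ι → ℝ) (u : ι → E) (i : ι) : svdMap s u v (v i) = s i • u i := by
  classical
  rw [svdMap, Finset.sum_eq_single i]
  · rw [real_inner_self_eq_norm_sq, hv.1 i]; simp
  · intro k _ hk; rw [hv.2 hk]; simp
  · simp

lemma sum_sq_inner_le {ι : Type*} [Fintype ι] {u : ι → E} (hu : Orthonormal ℝ u) (x : E) :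
    ∑ i, ⟪u i, x⟫ ^ 2 ≤ ‖x‖ ^ 2 := by
  simpa using hu.sum_inner_products_le (s := Finset.univ) x

/-- Dimension count behind Weyl's inequality: `i + 1` free coefficients against `i` linear
conditions. -/
lemma exists_ne_zero_inner_eq_zero {p q : ℕ} (v : Fin p → F) (v' : Fin q → F) (i : Fin p)
    (hi : (i : ℕ) ≤ q) : ∃ c : Fin p → ℝ, c ≠ 0 ∧ (∀ k, i < k → c k = 0) ∧
      ∀ l : Fin q, (l : ℕ) < i → ⟪v' l, ∑ k, c k • v k⟫ = 0 := by
  classical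
  -- Rows above `i` encode the orthogonality conditions and rows below `i` force the later
  -- coefficients to vanish; the zero row `i` makes the square system singular.
  let N : Matrix (Fin p) (Fin p) ℝ := fun l k =>
    if h : l < i then ⟪v' ⟨l, lt_of_lt_of_le h hi⟩, v k⟫ else if i < l then
      (if l = k then 1 else 0) else 0
  have hN : N.det = 0 := Matrix.det_eq_zero_of_row_eq_zero i fun k => by simp [N]
  obtain ⟨c, hc0, hc⟩ := Matrix.exists_mulVec_eq_zero_iff.2 hN
  refine ⟨c, hc0, fun k hk => ?_, fun l hl => ?_⟩
  · have := congrFun hc k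
    simpa [N, Matrix.mulVec, dotProduct, hk, not_lt.2 hk.le] using this
  · have := congrFun hc ⟨l, hl.trans i.2⟩
    have hl' : (⟨l, hl.trans i.2⟩ : Fin p) < i := hl
    simp only [N, Matrix.mulVec, dotProduct, hl', dite_true, Pi.zero_apply] at this
    rw [inner_sum, ← this]
    exact Finset.sum_congr rfl fun k _ => by rw [inner_smul_right, mul_comm]

/-- Weyl's inequality for singular values. -/
lemma singularValue_le_add {p q : ℕ} {s : Fin p → ℝ} {t : Fin q → ℝ} (hs : Antitone s)
    (hs0 : ∀ i, 0 ≤ s i) (ht : Antitone t) (ht0 : ∀ i, 0 ≤ t i) {u : Fin p → E} {v : Fin p → F}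
    {u' : Fin q → E} {v' : Fin q → F} (hu : Orthonormal ℝ u) (hv : Orthonormal ℝ v)
    (hu' : Orthonormal ℝ u') (hv' : Orthonormal ℝ v') {e : ℝ}
    (he : ∀ x, ‖svdMap s u v x - svdMap t u' v' x‖ ≤ e * ‖x‖) (i : Fin p) (j : Fin q)
    (hij : (i : ℕ) = j) : s i ≤ t j + e := by
  -- On this vector the first operator stretches by at least `s i` and the second by at most `t j`.
  obtain ⟨c, hc0, hck, hcl⟩ := exists_ne_zero_inner_eq_zero v v' i (hij ▸ j.2.le)
  set x := ∑ k, c k • v k with hx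
  have hxn : ‖x‖ ^ 2 = ∑ k, c k ^ 2 := norm_sq_sum_smul hv c
  have hxpos : 0 < ‖x‖ := by
    obtain ⟨k, hk⟩ := Function.ne_iff.1 hc0
    have : 0 < ‖x‖ ^ 2 := by
      rw [hxn]
      exact Finset.sum_pos' (fun _ _ => sq_nonneg _) ⟨k, Finset.mem_univ _, sq_pos_of_ne_zero hk⟩
    exact (norm_nonneg x).lt_of_ne' fun h => by simp [h] at this
  have hvx : ∀ k, ⟪v k, x⟫ = c k := fun k => hv.inner_right_fintype c k
  have h1 : s i * ‖x‖ ≤ ‖svdMap s u v x‖ := by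
    refine abs_le_of_sq_le_sq' ?_ (norm_nonneg _) |>.2
    rw [norm_sq_svdMap hu, mul_pow, hxn, Finset.mul_sum]
    refine Finset.sum_le_sum fun k _ => ?_
    rw [hvx, mul_pow]
    rcases lt_or_ge i k with h | h
    · simp [hck k h]
    · exact mul_le_mul_of_nonneg_right (pow_le_pow_left₀ (hs0 _) (hs h) 2) (sq_nonneg _)
  have h2 : ‖svdMap t u' v' x‖ ≤ t j * ‖x‖ := by
    refine abs_le_of_sq_le_sq' ?_ (mul_nonneg (ht0 _) (norm_nonneg _)) |>.2
    rw [norm_sq_svdMap hu', mul_pow]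
    refine le_trans ?_ (mul_le_mul_of_nonneg_left (sum_sq_inner_le hv' x) (sq_nonneg _))
    rw [Finset.mul_sum]
    refine Finset.sum_le_sum fun l _ => ?_
    rw [mul_pow]
    rcases lt_or_ge l j with h | h
    · rw [hcl l (by rw [hij]; exact h)]; simp
    · exact mul_le_mul_of_nonneg_right (pow_le_pow_left₀ (ht0 _) (ht h) 2) (sq_nonneg _)
  have h3 := norm_le_norm_add_norm_sub' (svdMap s u v x) (svdMap t u' v' x)
  have h4 := he x
  have : s i * ‖x‖ ≤ (t j + e) * ‖x‖ := by linarith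
  exact le_of_mul_le_mul_right this hxpos

/-- The right side is the expectation of `(lam I - lam K)²` for independent `I ∼ P`, `K ∼ Q`. The
left side keeps only the event that exactly one of `I`, `K` equals `j`. -/
lemma gap_le_double_variance {κ : Type*} [Fintype κ] [DecidableEq κ] {P Q lam : κ → ℝ} {γ : ℝ}
    (hP : ∀ i, 0 ≤ P i) (hQ : ∀ i, 0 ≤ Q i) (hP1 : ∑ i, P i = 1) (hQ1 : ∑ i, Q i = 1) (j : κ)
    (hγ : 0 ≤ γ) (hgap : ∀ i, i ≠ j → γ ≤ |lam i - lam j|) :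
    γ ^ 2 * (P j * (1 - Q j) + Q j * (1 - P j)) ≤
      ∑ i, lam i ^ 2 * (P i + Q i) - 2 * (∑ i, lam i * P i) * ∑ i, lam i * Q i := by
  have e1 : ∑ i, lam i ^ 2 * (P i + Q i) - 2 * (∑ i, lam i * P i) * ∑ i, lam i * Q i =
      ∑ i, ∑ k, (lam i - lam k) ^ 2 * (P i * Q k) := by
    have : ∀ i k, (lam i - lam k) ^ 2 * (P i * Q k) = lam i ^ 2 * P i * Q k
        + P i * (lam k ^ 2 * Q k) - 2 * (lam i * P i) * (lam k * Q k) := fun i k => by ring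
    simp only [this, Finset.sum_sub_distrib, Finset.sum_add_distrib, ← Finset.mul_sum,
      ← Finset.sum_mul, hP1, hQ1, mul_add]
    ring
  have hg : ∀ i, i ≠ j → γ ^ 2 ≤ (lam i - lam j) ^ 2 := fun i hi => by
    rw [← sq_abs (lam i - lam j)]; exact pow_le_pow_left₀ hγ (hgap i hi) 2
  have hP' : 1 - P j = ∑ i ∈ Finset.univ.erase j, P i := by
    rw [← hP1, ← Finset.add_sum_erase _ _ (Finset.mem_univ j)]; ring
  have hQ' : 1 - Q j = ∑ i ∈ Finset.univ.erase j, Q i := by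
    rw [← hQ1, ← Finset.add_sum_erase _ _ (Finset.mem_univ j)]; ring
  rw [e1, ← Finset.add_sum_erase _ _ (Finset.mem_univ j)]
  rw [mul_add]
  refine add_le_add ?_ ?_
  · rw [← Finset.add_sum_erase _ _ (Finset.mem_univ j), hQ', Finset.mul_sum, Finset.mul_sum]
    simp only [sub_self, ne_eq, OfNat.ofNat_ne_zero, not_false_eq_true, zero_pow, zero_mul, zero_add]
    refine Finset.sum_le_sum fun k hk => ?_
    have := hg k (Finset.ne_of_mem_erase hk)
    rw [← sq_abs (lam j - lam k), abs_sub_comm, sq_abs]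
    exact mul_le_mul_of_nonneg_right this (mul_nonneg (hP _) (hQ _))
  · rw [hP', Finset.mul_sum, Finset.mul_sum]
    refine Finset.sum_le_sum fun i hi => ?_
    refine le_trans ?_ (Finset.single_le_sum (f := fun k => (lam i - lam k) ^ 2 * (P i * Q k))
      (fun k _ => mul_nonneg (sq_nonneg _) (mul_nonneg (hP _) (hQ _))) (Finset.mem_univ j))
    have := hg i (Finset.ne_of_mem_erase hi)
    rw [mul_comm (Q j)]
    exact mul_le_mul_of_nonneg_right this (mul_nonneg (hP _) (hQ _))

lemma gap_le_second_moment {κ : Type*} [Fintype κ] [DecidableEq κ] {R lam : κ → ℝ} {γ l : ℝ}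
    (hR : ∀ i, 0 ≤ R i) (j : κ)
    (hgap : ∀ i, i ≠ j → γ ≤ |lam i - lam j|) (hl : |l - lam j| ≤ γ) :
    R j * |l - lam j| ^ 2 + (∑ i, R i - R j) * (γ - |l - lam j|) ^ 2 ≤
      ∑ i, R i * (lam i - l) ^ 2 := by
  rw [← Finset.add_sum_erase _ R (Finset.mem_univ j),
    ← Finset.add_sum_erase _ _ (Finset.mem_univ j), add_sub_cancel_left, Finset.sum_mul]
  refine add_le_add ?_ ?_
  · rw [sq_abs]; exact le_of_eq (by ring)
  · refine Finset.sum_le_sum fun i hi => mul_le_mul_of_nonneg_left ?_ (hR i)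
    rw [← sq_abs (lam i - l)]
    refine pow_le_pow_left₀ (by linarith) ?_ 2
    have h1 := hgap i (Finset.ne_of_mem_erase hi)
    have h2 := abs_sub_abs_le_abs_sub (lam i - lam j) (l - lam j)
    rw [sub_sub_sub_cancel_right] at h2
    linarith

/-- `P` and `Q` are the squared correlations on the two sides. Since `2e < γ`, `h1` yields `(2P -
1)(2Q - 1) > 0`, so both exceed 1/2 or both fall below it. The second-moment bound `h2` excludes the
low branch, and on the high one `1 - P ≤ P(1 - Q) + Q(1 - P)`. -/
lemma one_sub_le_of_branch {P Q e γ t : ℝ} (hQ1 : Q ≤ 1) (he : 2 * e < γ) (ht0 : 0 ≤ t) (ht : t ≤ e)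
    (h1 : γ ^ 2 * (P * (1 - Q) + Q * (1 - P)) ≤ 2 * e ^ 2)
    (h2 : (P + Q) * t ^ 2 + (2 - (P + Q)) * (γ - t) ^ 2 ≤ 2 * e ^ 2) :
    γ ^ 2 * (1 - P) ≤ 2 * e ^ 2 := by
  have hγ : 0 < γ := by linarith
  have hs : 1 ≤ P + Q := by
    by_contra! h
    have hA : 0 ≤ (e - t) * ((2 - (P + Q)) * γ - (e + t)) :=
      mul_nonneg (sub_nonneg.2 ht) (by nlinarith)
    have hB : 0 < (2 - (P + Q)) * (γ * (γ - 2 * e)) :=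
      mul_pos (by linarith) (mul_pos hγ (by linarith))
    linarith
  have h3 : 0 < (2 * P - 1) * (2 * Q - 1) := by
    have : 0 < γ ^ 2 * ((2 * P - 1) * (2 * Q - 1)) := by nlinarith
    exact (mul_pos_iff_of_pos_left (by positivity)).1 this
  have hP : 0 < 2 * P - 1 := by
    by_contra! h
    nlinarith
  have : 1 - P ≤ P * (1 - Q) + Q * (1 - P) := by nlinarith
  nlinarith [sq_nonneg γ]

/-- A singular pair of a perturbation of `∑ i, lam i • u i ⟨v i, ·⟩`, whose singular value is the
one close to `lam j`, is close to `u j`, as long as twice the perturbation is below the gap. -/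
lemma sq_gap_mul_sin_sq_le {ι : Type*} [Fintype ι] [DecidableEq ι] {lam : ι → ℝ}
    {u : ι → E} {v : ι → F} (hlam : ∀ i, 0 ≤ lam i) (hu : Orthonormal ℝ u) (hv : Orthonormal ℝ v)
    {x : E} {y : F} (hx : ‖x‖ = 1) (hy : ‖y‖ = 1) {l e γ : ℝ} (hl : 0 ≤ l)
    (h1 : ‖l • x - svdMap lam u v y‖ ≤ e) (h2 : ‖l • y - svdMap lam v u x‖ ≤ e) (j : ι)
    (hj : |l - lam j| ≤ e) (hgap : ∀ i, i ≠ j → γ ≤ |lam i - lam j|) (hγ : γ ≤ lam j)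
    (he : 2 * e < γ) : γ ^ 2 * (1 - ⟪u j, x⟫ ^ 2) ≤ 2 * e ^ 2 := by
  have he0 : 0 ≤ e := (abs_nonneg _).trans hj
  -- The extra atom `none`, with singular value 0, carries the mass outside the spans and makes `P`,
  -- `Q` probability weights; `γ ≤ lam j` is the gap to that atom.
  let P : Option ι → ℝ := fun i => i.elim (1 - ∑ k, ⟪u k, x⟫ ^ 2) fun k => ⟪u k, x⟫ ^ 2
  let Q : Option ι → ℝ := fun i => i.elim (1 - ∑ k, ⟪v k, y⟫ ^ 2) fun k => ⟪v k, y⟫ ^ 2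
  let L : Option ι → ℝ := fun i => i.elim 0 lam
  have hP0 : ∀ i, 0 ≤ P i := by
    rintro (_ | i)
    · have := sum_sq_inner_le hu x
      rw [hx] at this
      simp only [P, Option.elim_none]; linarith
    · exact sq_nonneg _
  have hQ0 : ∀ i, 0 ≤ Q i := by
    rintro (_ | i)
    · have := sum_sq_inner_le hv y
      rw [hy] at this
      simp only [Q, Option.elim_none]; linarith
    · exact sq_nonneg _
  have hP1 : ∑ i, P i = 1 := by rw [Fintype.sum_option]; simp [P]
  have hQ1 : ∑ i, Q i = 1 := by rw [Fintype.sum_option]; simp [Q]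
  have hL : ∀ i, i ≠ some j → γ ≤ |L i - L (some j)| := by
    rintro (_ | i) hi
    · simpa [L, abs_of_nonneg (hlam j)] using hγ
    · exact hgap i fun h => hi (by rw [h])
  set ρ := ∑ i, lam i * ⟪u i, x⟫ * ⟪v i, y⟫ with hρ
  have e1 : ‖l • x - svdMap lam u v y‖ ^ 2 = l ^ 2 - 2 * l * ρ + ∑ i, lam i ^ 2 * ⟪v i, y⟫ ^ 2 := by
    rw [@norm_sub_sq_real, norm_smul, hx, inner_smul_left, real_inner_comm, inner_svdMap,
      norm_sq_svdMap hu, ← hρ]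
    simp only [Real.norm_eq_abs, mul_one, sq_abs, mul_pow, conj_trivial]
    ring
  have e2 : ‖l • y - svdMap lam v u x‖ ^ 2 = l ^ 2 - 2 * l * ρ + ∑ i, lam i ^ 2 * ⟪u i, x⟫ ^ 2 := by
    rw [@norm_sub_sq_real, norm_smul, hy, inner_smul_left, real_inner_comm, inner_svdMap,
      norm_sq_svdMap hv]
    have : ∑ i, lam i * ⟪v i, y⟫ * ⟪u i, x⟫ = ρ :=
      Finset.sum_congr rfl fun i _ => by ring
    rw [this]
    simp only [Real.norm_eq_abs, mul_one, sq_abs, mul_pow, conj_trivial]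
    ring
  -- The sum of the two squared residuals feeds both bounds: minimizing over `l` and using `hcs`
  -- controls the double variance, while `hagm` with `l ≥ 0` controls the second moment about `l`.
  have hsum : 2 * l ^ 2 - 4 * l * ρ + ∑ i, L i ^ 2 * (P i + Q i) ≤ 2 * e ^ 2 := by
    have b1 := pow_le_pow_left₀ (norm_nonneg _) h1 2
    have b2 := pow_le_pow_left₀ (norm_nonneg _) h2 2
    have : ∑ i, L i ^ 2 * (P i + Q i) =
        ∑ i, lam i ^ 2 * ⟪u i, x⟫ ^ 2 + ∑ i, lam i ^ 2 * ⟪v i, y⟫ ^ 2 := by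
      rw [Fintype.sum_option, ← Finset.sum_add_distrib]; simp [L, P, Q, mul_add]
    rw [this]
    linarith
  have hLP : ∑ i, L i * P i = ∑ i, lam i * ⟪u i, x⟫ ^ 2 := by
    rw [Fintype.sum_option]; simp [L, P]
  have hLQ : ∑ i, L i * Q i = ∑ i, lam i * ⟪v i, y⟫ ^ 2 := by
    rw [Fintype.sum_option]; simp [L, Q]
  have hcs : ρ ^ 2 ≤ (∑ i, L i * P i) * ∑ i, L i * Q i := by
    rw [hLP, hLQ]
    refine Finset.sum_sq_le_sum_mul_sum_of_sq_le_mul _ (fun i _ => mul_nonneg (hlam i) (sq_nonneg _))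
      (fun i _ => mul_nonneg (hlam i) (sq_nonneg _)) fun i _ => le_of_eq (by ring)
  have hagm : 2 * ρ ≤ ∑ i, L i * (P i + Q i) := by
    simp only [mul_add, Finset.sum_add_distrib]
    rw [hLP, hLQ, ← Finset.sum_add_distrib, hρ, Finset.mul_sum]
    refine Finset.sum_le_sum fun i _ => ?_
    nlinarith [mul_nonneg (hlam i) (sq_nonneg (⟪u i, x⟫ - ⟪v i, y⟫))]
  have m1 := gap_le_double_variance hP0 hQ0 hP1 hQ1 (some j)
    (show (0 : ℝ) ≤ γ by linarith) hL
  have m2 := gap_le_second_moment (R := fun i => P i + Q i) (l := l)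
    (fun i => add_nonneg (hP0 i) (hQ0 i)) (some j) hL (show |l - lam j| ≤ γ by linarith)
  have hle : ∀ {R : Option ι → ℝ}, (∀ i, 0 ≤ R i) → ∑ i, R i = 1 → R (some j) ≤ 1 :=
    fun h0 h1 => h1 ▸ Finset.single_le_sum (fun i _ => h0 i) (Finset.mem_univ _)
  refine one_sub_le_of_branch (Q := Q (some j)) (t := |l - lam j|)
    (hle hQ0 hQ1) he (abs_nonneg _) hj (m1.trans ?_) ?_
  · nlinarith [sq_nonneg (l - ρ)]
  · have e3 : ∑ i, (P i + Q i) * (L i - l) ^ 2 = ∑ i, L i ^ 2 * (P i + Q i)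
        - 2 * l * ∑ i, L i * (P i + Q i) + 2 * l ^ 2 := by
      have : ∀ i, (P i + Q i) * (L i - l) ^ 2 = L i ^ 2 * (P i + Q i)
        - 2 * l * (L i * (P i + Q i)) + (P i + Q i) * l ^ 2 := fun i => by ring
      simp only [this, Finset.sum_sub_distrib, Finset.sum_add_distrib, ← Finset.mul_sum,
        ← Finset.sum_mul, hP1, hQ1]
      norm_num
    rw [e3, Finset.sum_add_distrib, hP1, hQ1, one_add_one_eq_two] at m2
    refine m2.trans ?_
    nlinarith [mul_le_mul_of_nonneg_left hagm hl]

end SVD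

/-! ### Polar factor of a nearly orthonormal matrix -/

section Polar

open scoped Matrix.Norms.L2Operator RealInnerProductSpace MatrixOrder
open Matrix WithLp

variable {m n ι : Type} [Fintype m] [Fintype n] [DecidableEq m] [DecidableEq n]
  [Fintype ι] [DecidableEq ι]

lemma norm_toLp_mulVec_of_transpose_mul_self {U : Matrix m ι ℝ} (hU : Uᵀ * U = 1)
    (x : EuclideanSpace ℝ ι) : ‖toLp 2 (U *ᵥ x.ofLp)‖ = ‖x‖ := by
  have : ‖toLp 2 (U *ᵥ x.ofLp)‖ ^ 2 = ‖x‖ ^ 2 := by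
    rw [← real_inner_self_eq_norm_sq, ← real_inner_self_eq_norm_sq]
    rw [← inner_toLp_transpose_mulVec]
    simp [mulVec_mulVec, hU]
  exact (pow_left_inj₀ (norm_nonneg _) (norm_nonneg _) two_ne_zero).1 this

/-- `(H + 1)(H - 1) = G - 1` for the positive square root `H`. As `H + 1` does not shrink vectors,
`‖H - 1‖ ≤ δ`; writing `H + 1 = 2 + (H - 1)` sharpens this to the quadratic bound, which supplies
the factor of almost 1/2. -/
lemma exists_sqrt_near_one {G : Matrix ι ι ℝ} (hG : G.PosSemidef) {δ : ℝ}
    (hδ : specNorm (G - 1) ≤ δ) (hδ1 : δ < 1) :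
    ∃ H : Matrix ι ι ℝ, Hᵀ = H ∧ H * H = G ∧ IsUnit H ∧ specNorm (H - 1) ≤ δ ∧
      specNorm (H - 1) * (2 - specNorm (H - 1)) ≤ δ := by
  have hG0 : 0 ≤ G := Matrix.nonneg_iff_posSemidef.2 hG
  have hH : (CFC.sqrt G).PosSemidef := Matrix.nonneg_iff_posSemidef.1 (CFC.sqrt_nonneg G)
  have hHH : CFC.sqrt G * CFC.sqrt G = G := CFC.sqrt_mul_sqrt_self G hG0
  set H := CFC.sqrt G
  have hδ0 : 0 ≤ δ := (specNorm_nonneg _).trans hδ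
  have hT : Hᵀ = H := by
    rw [← Matrix.conjTranspose_eq_transpose_of_trivial]; exact hH.1
  have hunit : IsUnit H := by
    have h1 : IsUnit (1 - (1 - G)) := by
      refine isUnit_one_sub_of_norm_lt_one ?_
      rw [norm_sub_rev]; exact hδ.trans_lt hδ1
    rw [sub_sub_cancel, ← hHH] at h1
    exact isUnit_of_mul_isUnit_left h1
  have key : ∀ x : EuclideanSpace ℝ ι, ∀ y : EuclideanSpace ℝ ι,
      y = toLp 2 ((H - 1) *ᵥ x.ofLp) → ‖toLp 2 (H *ᵥ y.ofLp) + y‖ ≤ δ * ‖x‖ := by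
    intro x y hy
    have : toLp 2 (H *ᵥ y.ofLp) + y = toLp 2 ((G - 1) *ᵥ x.ofLp) := by
      rw [hy, ← toLp_add]
      congr 1
      simp only [mulVec_mulVec, ← add_mulVec]
      rw [← hHH]; congr 1; noncomm_ring
    rw [this]
    exact (norm_toLp_mulVec_le _ x).trans (mul_le_mul_of_nonneg_right hδ (norm_nonneg _))
  refine ⟨H, hT, hHH, hunit, specNorm_le_of_forall _ hδ0 fun x => ?_, ?_⟩
  · set y := toLp 2 ((H - 1) *ᵥ x.ofLp) with hy
    have h1 : 0 ≤ ⟪y, toLp 2 (H *ᵥ y.ofLp)⟫ := by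
      have := hH.dotProduct_mulVec_nonneg y.ofLp
      rw [EuclideanSpace.inner_eq_star_dotProduct, dotProduct_comm]
      simpa using this
    refine le_trans ?_ (key x y hy)
    refine abs_le_of_sq_le_sq' ?_ (norm_nonneg _) |>.2
    rw [norm_add_sq_real, real_inner_comm]
    nlinarith [sq_nonneg ‖toLp 2 (H *ᵥ y.ofLp)‖]
  · set η := specNorm (H - 1)
    by_cases hη : 2 - η ≤ 0
    · exact (mul_nonpos_of_nonneg_of_nonpos (specNorm_nonneg _) hη).trans hδ0
    push Not at hη
    rw [← le_div_iff₀ hη]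
    refine specNorm_le_of_forall _ (by positivity) fun x => ?_
    set y := toLp 2 ((H - 1) *ᵥ x.ofLp) with hy
    have h1 := key x y hy
    have h2 : toLp 2 (H *ᵥ y.ofLp) + y = (2 : ℝ) • y + toLp 2 ((H - 1) *ᵥ y.ofLp) := by
      rw [sub_mulVec, one_mulVec, toLp_sub, two_smul]; simp [add_comm]
    have h3 : ‖(2 : ℝ) • y‖ ≤ ‖(2 : ℝ) • y + toLp 2 ((H - 1) *ᵥ y.ofLp)‖ +
      ‖toLp 2 ((H - 1) *ᵥ y.ofLp)‖ := by
      have := norm_sub_le ((2 : ℝ) • y + toLp 2 ((H - 1) *ᵥ y.ofLp)) (toLp 2 ((H - 1) *ᵥ y.ofLp))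
      rwa [add_sub_cancel_right] at this
    have h4 := norm_toLp_mulVec_le (H - 1) y
    rw [← h2, norm_smul, Real.norm_eq_abs, abs_two] at h3
    rw [div_mul_eq_mul_div, le_div_iff₀ hη]
    have h5 : ‖toLp 2 ((H - 1) *ᵥ y.ofLp)‖ ≤ η * ‖y‖ := h4
    linarith

/-- A matrix with nearly orthonormal columns is close to one with orthonormal columns. -/
lemma exists_orthonormal_columns_near {A : Matrix m ι ℝ} {δ : ℝ}
    (hδ : specNorm (Aᵀ * A - 1) ≤ δ) (hδ1 : δ < 1) :
    ∃ U : Matrix m ι ℝ, Uᵀ * U = 1 ∧ ∃ η, 0 ≤ η ∧ specNorm (A - U) ≤ η ∧ η ≤ δ ∧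
      η * (2 - η) ≤ δ := by
  obtain ⟨H, hT, hHH, hunit, h1, h2⟩ := exists_sqrt_near_one
    (by simpa using Matrix.posSemidef_conjTranspose_mul_self A) hδ hδ1
  have hdet : IsUnit H.det := (Matrix.isUnit_iff_isUnit_det H).1 hunit
  have hU : (A * H⁻¹)ᵀ * (A * H⁻¹) = 1 := by
    rw [transpose_mul, transpose_nonsing_inv, hT, Matrix.mul_assoc, ← Matrix.mul_assoc Aᵀ, ← hHH,
      Matrix.mul_assoc H, mul_nonsing_inv _ hdet, Matrix.mul_one, nonsing_inv_mul _ hdet]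
  refine ⟨A * H⁻¹, hU, _, specNorm_nonneg _, specNorm_le_of_forall _ (specNorm_nonneg _)
    fun x => ?_, h1, h2⟩
  -- `A * H⁻¹` is an isometry, so the distance to `A` is governed by `H - 1`.
  have : A - A * H⁻¹ = A * H⁻¹ * (H - 1) := by
    rw [Matrix.mul_sub, Matrix.mul_assoc, nonsing_inv_mul _ hdet, Matrix.mul_one, Matrix.mul_one]
  rw [this, ← mulVec_mulVec]
  exact (norm_toLp_mulVec_of_transpose_mul_self hU (toLp 2 ((H - 1) *ᵥ x.ofLp))).trans_le
    (norm_toLp_mulVec_le _ x)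

/-- The `j`-th column of a matrix, as a Euclidean vector. -/
def colVec (A : Matrix m ι ℝ) (j : ι) : EuclideanSpace ℝ m := toLp 2 fun i => A i j

lemma colVec_eq (A : Matrix m ι ℝ) (j : ι) :
    colVec A j = toLp 2 (A *ᵥ (EuclideanSpace.single j (1 : ℝ)).ofLp) := by
  ext i; simp [colVec]

lemma norm_colVec_sub_le (A U : Matrix m ι ℝ) (j : ι) :
    ‖colVec A j - colVec U j‖ ≤ specNorm (A - U) := by
  rw [colVec_eq, colVec_eq, ← toLp_sub, ← sub_mulVec]
  exact (norm_toLp_mulVec_le (A - U) (EuclideanSpace.single j (1 : ℝ))).trans_eq (by simp)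

lemma orthonormal_colVec {U : Matrix m ι ℝ} (hU : Uᵀ * U = 1) : Orthonormal ℝ (colVec U) := by
  rw [orthonormal_iff_ite]
  intro i j
  have := congrFun (congrFun hU i) j
  rw [Matrix.one_apply] at this
  rw [← this]
  simp [colVec, PiLp.inner_apply, Matrix.mul_apply, mul_comm]

lemma svdMap_colVec (lam : ι → ℝ) (U : Matrix m ι ℝ) (V : Matrix n ι ℝ)
    (x : EuclideanSpace ℝ n) :
    svdMap lam (colVec U) (colVec V) x = toLp 2 ((U * diagonal lam * Vᵀ) *ᵥ x.ofLp) := by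
  ext i
  simp only [svdMap, ofLp_sum, Finset.sum_apply, ofLp_smul, Pi.smul_apply, smul_eq_mul, colVec,
    ← mulVec_mulVec, PiLp.inner_apply, RCLike.inner_apply, conj_trivial]
  simp only [mulVec, dotProduct, transpose_apply]
  refine Finset.sum_congr rfl fun j _ => ?_
  rw [show ∑ k, x.ofLp k * V k j = ∑ k, V k j * x.ofLp k from
    Finset.sum_congr rfl fun k _ => mul_comm _ _,
    Finset.sum_eq_single j (fun k _ hk => by rw [diagonal_apply_ne _ hk.symm, zero_mul])
      (by simp), diagonal_apply_eq]
  ring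

lemma svdMap_eq_mulVec {κ : Type*} [Fintype κ] (s : κ → ℝ) (u : κ → EuclideanSpace ℝ m)
    (v : κ → EuclideanSpace ℝ n) (x : EuclideanSpace ℝ n) :
    svdMap s u v x = toLp 2 ((∑ i, s i • outer (u i) (v i)) *ᵥ x.ofLp) := by
  rw [sum_mulVec, toLp_sum, svdMap]
  refine Finset.sum_congr rfl fun i _ => ?_
  rw [smul_mulVec, toLp_smul, outer_mulVec, smul_smul]

lemma specNorm_mul_le (A : Matrix m ι ℝ) (B : Matrix ι n ℝ) :
    specNorm (A * B) ≤ specNorm A * specNorm B := Matrix.l2_opNorm_mul A B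

lemma specNorm_diagonal_le {lam : ι → ℝ} {L : ℝ} (hL : 0 ≤ L) (h0 : ∀ i, 0 ≤ lam i)
    (h : ∀ i, lam i ≤ L) : specNorm (diagonal lam) ≤ L := by
  unfold specNorm
  rw [Matrix.l2_opNorm_diagonal, pi_norm_le_iff_of_nonneg hL]
  intro i
  rw [Real.norm_eq_abs, abs_of_nonneg (h0 i)]
  exact h i

lemma specNorm_le_one_of_transpose_mul_self {U : Matrix m ι ℝ} (hU : Uᵀ * U = 1) :
    specNorm U ≤ 1 :=
  specNorm_le_of_forall _ zero_le_one fun x => by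
    rw [norm_toLp_mulVec_of_transpose_mul_self hU, one_mul]

lemma specNorm_mul_diagonal_mul_transpose_sub_le {A U : Matrix m ι ℝ} {B V : Matrix n ι ℝ}
    (hU : Uᵀ * U = 1) (hV : Vᵀ * V = 1) {lam : ι → ℝ} {L η : ℝ} (hL : 0 ≤ L)
    (h0 : ∀ i, 0 ≤ lam i) (h : ∀ i, lam i ≤ L) (hA : specNorm (A - U) ≤ η)
    (hB : specNorm (B - V) ≤ η) :
    specNorm (A * diagonal lam * Bᵀ - U * diagonal lam * Vᵀ) ≤ L * (η * (2 + η)) := by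
  have hη : 0 ≤ η := (specNorm_nonneg _).trans hA
  have hD := specNorm_diagonal_le hL h0 h
  have hBn : specNorm B ≤ 1 + η := by
    have := specNorm_add_le V (B - V)
    rw [add_sub_cancel] at this
    linarith [specNorm_le_one_of_transpose_mul_self hV]
  have e : A * diagonal lam * Bᵀ - U * diagonal lam * Vᵀ =
      (A - U) * diagonal lam * Bᵀ + U * diagonal lam * (B - V)ᵀ := by
    rw [transpose_sub, Matrix.mul_sub, Matrix.sub_mul, Matrix.sub_mul]; abel
  have h1 : specNorm ((A - U) * diagonal lam * Bᵀ) ≤ η * L * (1 + η) := by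
    refine (specNorm_mul_le _ _).trans ?_
    rw [specNorm_transpose]
    exact mul_le_mul ((specNorm_mul_le _ _).trans (mul_le_mul hA hD (specNorm_nonneg _) hη)) hBn
      (specNorm_nonneg _) (by positivity)
  have h2 : specNorm (U * diagonal lam * (B - V)ᵀ) ≤ 1 * L * η := by
    refine (specNorm_mul_le _ _).trans ?_
    rw [specNorm_transpose]
    exact mul_le_mul ((specNorm_mul_le _ _).trans (mul_le_mul
      (specNorm_le_one_of_transpose_mul_self hU) hD (specNorm_nonneg _) zero_le_one)) hB
      (specNorm_nonneg _) (by positivity)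
  rw [e]
  linarith [specNorm_add_le ((A - U) * diagonal lam * Bᵀ) (U * diagonal lam * (B - V)ᵀ)]

end Polar

/-! ### Deterministic bound for the singular vectors of the unfolding -/

section Deterministic

open scoped Matrix.Norms.L2Operator RealInnerProductSpace
open Matrix WithLp

variable {m n : Type} [Fintype m] [Fintype n] [DecidableEq m] [DecidableEq n]

lemma one_sub_sq_inner_le {E : Type*} [NormedAddCommGroup E] [InnerProductSpace ℝ E] {x a u : E}
    (hx : ‖x‖ = 1) (ha : ‖a‖ = 1) (hu : ‖u‖ = 1) {c η : ℝ} (hc : 0 ≤ c)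
    (h : 1 - ⟪u, x⟫ ^ 2 ≤ c ^ 2) (hη : ‖a - u‖ ≤ η) : 1 - ⟪x, a⟫ ^ 2 ≤ (c + η) ^ 2 := by
  have e1 : 1 - ⟪x, a⟫ ^ 2 = ‖a - ⟪x, a⟫ • x‖ ^ 2 := by rw [norm_sub_inner_smul_sq hx, ha]; ring
  have e2 : a - ⟪x, a⟫ • x = (u - ⟪x, u⟫ • x) + ((a - u) - ⟪x, a - u⟫ • x) := by
    rw [inner_sub_right, sub_smul]; abel
  have e3 : ‖u - ⟪x, u⟫ • x‖ ≤ c := by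
    refine abs_le_of_sq_le_sq' ?_ hc |>.2
    rw [norm_sub_inner_smul_sq hx, hu, real_inner_comm]; linarith
  have e4 : ‖(a - u) - ⟪x, a - u⟫ • x‖ ≤ ‖a - u‖ := by
    refine abs_le_of_sq_le_sq' ?_ (norm_nonneg _) |>.2
    rw [norm_sub_inner_smul_sq hx]; linarith [sq_nonneg ⟪x, a - u⟫]
  rw [e1, e2]
  exact pow_le_pow_left₀ (norm_nonneg _) ((norm_add_le _ _).trans (by linarith)) 2

lemma norm_svdMap_sub_le {p r : ℕ} {M : Matrix m n ℝ} {s : Fin p → ℝ}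
    {u : Fin p → EuclideanSpace ℝ m} {v : Fin p → EuclideanSpace ℝ n}
    (hM : M = ∑ i, s i • outer (u i) (v i)) {lam : Fin r → ℝ} {U : Matrix m (Fin r) ℝ}
    {V : Matrix n (Fin r) ℝ} {e : ℝ} (he : specNorm (M - U * diagonal lam * Vᵀ) ≤ e)
    (x : EuclideanSpace ℝ n) :
    ‖svdMap s u v x - svdMap lam (colVec U) (colVec V) x‖ ≤ e * ‖x‖ := by
  rw [svdMap_eq_mulVec, ← hM, svdMap_colVec, ← toLp_sub, ← sub_mulVec]
  exact (norm_toLp_mulVec_le _ _).trans (mul_le_mul_of_nonneg_right he (norm_nonneg _))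

lemma transpose_eq_sum_outer {κ : Type*} [Fintype κ] {M : Matrix m n ℝ} {s : κ → ℝ}
    {u : κ → EuclideanSpace ℝ m} {v : κ → EuclideanSpace ℝ n}
    (hM : M = ∑ i, s i • outer (u i) (v i)) : Mᵀ = ∑ i, s i • outer (v i) (u i) := by
  rw [hM, transpose_sum]
  refine Finset.sum_congr rfl fun i _ => ?_
  rw [transpose_smul]; congr 1
  ext a b; simp [outer, vecMulVec_apply, mul_comm]

/-- Perturbation bound for the left singular vectors of `A diag(lam) Bᵀ + noise`, where `A` and `B`
have nearly orthonormal columns. -/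
lemma one_sub_sq_inner_colVec_le {p r : ℕ} {M : Matrix m n ℝ} {s : Fin p → ℝ}
    {u : Fin p → EuclideanSpace ℝ m} {v : Fin p → EuclideanSpace ℝ n}
    (hM : M = ∑ i, s i • outer (u i) (v i)) (hs0 : ∀ i, 0 ≤ s i) (hs : Antitone s)
    (hu : Orthonormal ℝ u) (hv : Orthonormal ℝ v)
    {A : Matrix m (Fin r) ℝ} {B : Matrix n (Fin r) ℝ} {lam : Fin r → ℝ} (hlam0 : ∀ i, 0 ≤ lam i)
    (hlam : Antitone lam) {L δ ψ γ : ℝ} (hL : ∀ i, lam i ≤ L)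
    (hA : specNorm (Aᵀ * A - 1) ≤ δ) (hB : specNorm (Bᵀ * B - 1) ≤ δ)
    (hψ : specNorm (M - A * diagonal lam * Bᵀ) ≤ ψ) (j : Fin r) (hr : r ≤ p) (hγ0 : 0 < γ)
    (hgap : ∀ i, i ≠ j → γ ≤ |lam i - lam j|) (hγ : γ ≤ lam j) (hAj : ‖colVec A j‖ = 1)
    (hR : (1 + 2 * √2 * L / γ) * δ + 2 * ψ / γ < 1) :
    1 - ⟪u (Fin.castLE hr j), colVec A j⟫ ^ 2 ≤
      ((1 + 2 * √2 * L / γ) * δ + 2 * ψ / γ) ^ 2 / 2 := by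
  have hγL : γ ≤ L := hγ.trans (hL j)
  have hL0 : 0 ≤ L := hγ0.le.trans hγL
  have hδ0 : 0 ≤ δ := (specNorm_nonneg _).trans hA
  have hψ0 : 0 ≤ ψ := (specNorm_nonneg _).trans hψ
  set q := √2 with hq
  have hq2 : q * q = 2 := Real.mul_self_sqrt (by norm_num)
  have hq0 : 0 ≤ q := Real.sqrt_nonneg _
  have hq1 : 1.41 ≤ q := by rw [hq]; exact Real.le_sqrt_of_sq_le (by norm_num)
  have hq3 : q ≤ 1.5 := by rw [hq]; exact (Real.sqrt_le_left (by norm_num)).2 (by norm_num)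
  have hLγ : 1 ≤ L / γ := (one_le_div hγ0).2 hγL
  set R := (1 + 2 * q * L / γ) * δ + 2 * ψ / γ with hRdef
  have hRexp : R = δ + 2 * q * (L / γ) * δ + 2 * ψ / γ := by rw [hRdef]; ring
  have hψγ : 0 ≤ 2 * ψ / γ := by positivity
  -- From `R < 1` and `L / γ ≥ 1` follows `3.82 δ < 1`. Then `η ≤ δ < 0.27` gives `(2 - 0.27) η ≤ δ`
  -- and `η(2 + η) ≤ 2.27 η ≤ √2 δ`, the source of the `√2` in the statement.
  have hδ1 : δ < 0.27 := by
    by_contra! h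
    have h1 : 2.82 * 1 ≤ 2 * q * (L / γ) := mul_le_mul (by linarith) hLγ zero_le_one (by linarith)
    nlinarith [mul_le_mul h1 h (by norm_num) (by positivity)]
  obtain ⟨U, hU, η₁, hη₁0, hAU, hη₁δ, hη₁⟩ := exists_orthonormal_columns_near hA (by linarith)
  obtain ⟨V, hV, η₂, hη₂0, hBV, hη₂δ, hη₂⟩ := exists_orthonormal_columns_near hB (by linarith)
  set η := max η₁ η₂ with hη
  have hη0 : 0 ≤ η := le_max_of_le_left hη₁0
  have hη17 : 1.73 * η ≤ δ := by
    rcases max_cases η₁ η₂ with h | h <;> rw [hη, h.1] <;> nlinarith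
  have hηδ : η * (2 + η) ≤ q * δ := by
    have h1 : η * η ≤ 0.27 * η := mul_le_mul_of_nonneg_right (by linarith) hη0
    have h2 : 1.41 * δ ≤ q * δ := mul_le_mul_of_nonneg_right hq1 hδ0
    linarith
  set e := L * (η * (2 + η)) + ψ with he
  have hMe : specNorm (M - U * diagonal lam * Vᵀ) ≤ e := by
    have := specNorm_add_le (M - A * diagonal lam * Bᵀ)
      (A * diagonal lam * Bᵀ - U * diagonal lam * Vᵀ)
    rw [sub_add_sub_cancel] at this
    have h2 := specNorm_mul_diagonal_mul_transpose_sub_le hU hV hL0 hlam0 hL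
      (hAU.trans (le_max_left η₁ η₂)) (hBV.trans (le_max_right η₁ η₂))
    linarith
  have he0 : 0 ≤ e := (specNorm_nonneg _).trans hMe
  have heγ : 2 * (e / γ) + δ ≤ R := by
    rw [hRexp, he]
    have : L / γ * (η * (2 + η)) ≤ L / γ * (q * δ) := mul_le_mul_of_nonneg_left hηδ (by positivity)
    have e1 : 2 * ((L * (η * (2 + η)) + ψ) / γ) = 2 * (L / γ * (η * (2 + η))) + 2 * ψ / γ := by
      ring
    rw [e1]; linarith
  have he2 : 2 * e < γ := by
    have : 2 * (e / γ) < 1 := by linarith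
    rw [← mul_div_assoc, div_lt_one hγ0] at this
    exact this
  have hU' := orthonormal_colVec hU
  have hV' := orthonormal_colVec hV
  have d1 := norm_svdMap_sub_le hM hMe
  have d2 : ∀ x, ‖svdMap s v u x - svdMap lam (colVec V) (colVec U) x‖ ≤ e * ‖x‖ := by
    refine norm_svdMap_sub_le (transpose_eq_sum_outer hM) ?_
    rw [← specNorm_transpose]
    simpa [Matrix.mul_assoc] using hMe
  set i := Fin.castLE hr j
  have w1 := singularValue_le_add hs hs0 hlam hlam0 hu hv hU' hV' d1 i j rfl
  have w2 := singularValue_le_add hlam hlam0 hs hs0 hU' hV' hu hv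
    (fun x => by rw [norm_sub_rev]; exact d1 x) j i rfl
  have d1i := d1 (v i)
  have d2i := d2 (u i)
  rw [svdMap_apply_right hv, hv.1 i, mul_one] at d1i
  rw [svdMap_apply_right hu, hu.1 i, mul_one] at d2i
  have main := sq_gap_mul_sin_sq_le hlam0 hU' hV' (hu.1 i) (hv.1 i) (hs0 i) d1i d2i j
    (abs_le.2 ⟨by linarith, by linarith⟩) hgap hγ he2
  have main' : 1 - ⟪colVec U j, u i⟫ ^ 2 ≤ (q * (e / γ)) ^ 2 := by
    have : (q * (e / γ)) ^ 2 = (2 * e ^ 2) / γ ^ 2 := by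
      rw [mul_pow, div_pow, sq q, hq2]; ring
    rw [this, le_div_iff₀ (by positivity)]
    linarith
  have fin := one_sub_sq_inner_le (hu.1 i) hAj (hU'.1 j) (by positivity) main'
    ((norm_colVec_sub_le A U j).trans (hAU.trans (le_max_left η₁ η₂)))
  refine fin.trans ?_
  -- The spare factor `√2` secures correlation above 1/2 later; it fits because `√2 η ≤ δ`.
  have hfin : q * (q * (e / γ) + η) ≤ R := by
    have h1 : q * η ≤ 1.5 * η := mul_le_mul_of_nonneg_right hq3 hη0
    have h2 : q * (q * (e / γ) + η) = 2 * (e / γ) + q * η := by rw [mul_add, ← mul_assoc, hq2]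
    linarith
  have h0 : 0 ≤ q * (q * (e / γ) + η) := by positivity
  have := pow_le_pow_left₀ h0 hfin 2
  rw [mul_pow, sq q, hq2] at this
  linarith

end Deterministic

/-! ### Exponential moments of a Gaussian matrix applied to a vector -/

section GaussianMatrix

open scoped ENNReal RealInnerProductSpace
open Matrix WithLp Metric

variable {Ω : Type*} [MeasurableSpace Ω] {P : Measure Ω} [IsProbabilityMeasure P]

lemma lintegral_exp_sq_gaussianReal_le {v w : ℝ≥0} (hv : 0 < v) (hw : w ≤ v) :
    ∫⁻ y, ENNReal.ofReal (Real.exp (3 / (8 * v) * y ^ 2)) ∂(gaussianReal 0 w) ≤ 2 := by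
  have hmap : gaussianReal 0 w = (gaussianReal 0 1).map (√w * ·) := by
    rw [gaussianReal_map_const_mul]
    congr 1
    · simp
    · ext; simp
  have hv' : (0 : ℝ) < v := hv
  have hw' : (w : ℝ) ≤ v := hw
  rw [hmap, lintegral_map (by fun_prop) (by fun_prop),
    gaussianReal_of_var_ne_zero _ one_ne_zero,
    lintegral_withDensity_eq_lintegral_mul _ (measurable_gaussianPDF _ _) (by fun_prop)]
  -- The rate 3/8 leaves the exponent `-x²/8`, a Gaussian of standard deviation 2, hence total mass
  -- 2.
  have hint : ∫⁻ x : ℝ, ENNReal.ofReal ((√(2 * Real.pi))⁻¹ * Real.exp (-(1 / 8) * x ^ 2)) = 2 := by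
    rw [← ofReal_integral_eq_lintegral_ofReal
      ((integrable_exp_neg_mul_sq (by norm_num)).const_mul _)
      (Filter.Eventually.of_forall fun x => by positivity), integral_const_mul, integral_gaussian]
    rw [← ENNReal.ofReal_ofNat 2]
    congr 1
    rw [show Real.pi / (1 / 8) = 2 ^ 2 * (2 * Real.pi) by ring,
      Real.sqrt_mul (by norm_num) (2 * Real.pi), Real.sqrt_sq (by norm_num)]
    have : √(2 * Real.pi) ≠ 0 := by positivity
    field_simp
  rw [← hint]
  refine lintegral_mono fun x => ?_
  simp only [Pi.mul_apply, gaussianPDF, gaussianPDFReal]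
  rw [← ENNReal.ofReal_mul (by positivity)]
  refine ENNReal.ofReal_le_ofReal ?_
  rw [mul_assoc, ← Real.exp_add]
  simp only [NNReal.coe_one, mul_one, sub_zero]
  refine mul_le_mul_of_nonneg_left (Real.exp_le_exp.2 ?_) (by positivity)
  rw [mul_pow, Real.sq_sqrt w.coe_nonneg]
  have : 3 / (8 * (v : ℝ)) * (w * x ^ 2) ≤ 3 / 8 * x ^ 2 := by
    rw [div_mul_eq_mul_div, div_le_iff₀ (by positivity)]
    nlinarith [mul_le_mul_of_nonneg_right hw' (sq_nonneg x)]
  linarith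

lemma map_sum_mul_eq_gaussianReal {κ : Type*} [Fintype κ] {X : κ → Ω → ℝ} {v w : ℝ≥0}
    (hm : ∀ i, Measurable (X i)) (hX : iIndepFun X P) (hlaw : ∀ i, P.map (X i) = gaussianReal 0 v)
    (c : κ → ℝ) (hw : (w : ℝ) = v * ∑ i, c i ^ 2) :
    P.map (fun ω => ∑ i, c i * X i ω) = gaussianReal 0 w := by
  have hind : iIndepFun (fun i ω => c i * X i ω) P :=
    hX.comp (fun i => (c i * ·)) fun i => by fun_prop
  have : IsProbabilityMeasure (P.map (fun ω => ∑ i, c i * X i ω)) :=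
    Measure.isProbabilityMeasure_map (by fun_prop)
  refine Measure.ext_of_charFun ?_
  rw [hind.charFun_map_fun_sum_eq_prod (fun i => by fun_prop)]
  ext t
  rw [Finset.prod_apply, charFun_gaussianReal]
  have : ∀ i, charFun (P.map fun ω => c i * X i ω) t =
      Complex.exp (-(v * (c i) ^ 2 * t ^ 2 / 2 : ℂ)) := by
    intro i
    rw [show (fun ω => c i * X i ω) = (c i * ·) ∘ X i from rfl,
      ← Measure.map_map (by fun_prop) (hm i), hlaw, gaussianReal_map_const_mul,
      charFun_gaussianReal]
    congr 1
    simp only [mul_zero, Complex.ofReal_zero, zero_mul, zero_sub, NNReal.coe_mul, NNReal.coe_mk,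
      Complex.ofReal_mul, Complex.ofReal_pow]
    ring
  simp only [this]
  rw [← Complex.exp_sum]
  congr 1
  have hw' : (w : ℂ) = v * ∑ i, (c i : ℂ) ^ 2 := by
    have := congrArg (fun x : ℝ => (x : ℂ)) hw
    push_cast at this
    exact this
  rw [hw', Finset.sum_neg_distrib, ← Finset.sum_div, ← Finset.sum_mul, ← Finset.mul_sum]
  simp

variable {m n : Type} [Fintype m] [Fintype n] [DecidableEq m] [DecidableEq n]

lemma map_sum_row_eq_gaussianReal {X : m → n → Ω → ℝ} {v w : ℝ≥0}
    (hm : ∀ i j, Measurable (X i j)) (hX : iIndepFun (fun q : m × n => X q.1 q.2) P)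
    (hlaw : ∀ i j, P.map (X i j) = gaussianReal 0 v) (g : n → ℝ) (i : m)
    (hw : (w : ℝ) = v * ∑ j, g j ^ 2) :
    P.map (fun ω => ∑ j, X i j ω * g j) = gaussianReal 0 w := by
  have := map_sum_mul_eq_gaussianReal (hm i)
    (hX.precomp (g := fun j : n => (i, j)) fun a b h => (Prod.ext_iff.1 h).2) (hlaw i) g hw
  simpa only [mul_comm] using this

/-- The joint characteristic function at `t` is that of one linear combination of all entries, with
coefficients `t i * g j`, evaluated at 1; it factors over the rows. -/
lemma iIndepFun_sum_row {X : m → n → Ω → ℝ} {v : ℝ≥0}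
    (hm : ∀ i j, Measurable (X i j)) (hX : iIndepFun (fun q : m × n => X q.1 q.2) P)
    (hlaw : ∀ i j, P.map (X i j) = gaussianReal 0 v) (g : n → ℝ) :
    iIndepFun (fun (i : m) ω => ∑ j, X i j ω * g j) P := by
  set w : ℝ≥0 := v * ∑ j, (‖g j‖₊) ^ 2 with hw
  have hw' : (w : ℝ) = v * ∑ j, g j ^ 2 := by simp [hw]
  rw [iIndepFun_iff_charFun_pi fun i => by fun_prop]
  intro t
  simp only [map_sum_row_eq_gaussianReal hm hX hlaw g _ hw']
  set c : m × n → ℝ := fun q => t q.1 * g q.2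
  set w2 : ℝ≥0 := v * ∑ q, (‖c q‖₊) ^ 2 with hw2
  have hw2' : (w2 : ℝ) = v * ∑ q, c q ^ 2 := by simp [hw2]
  have h1 := map_sum_mul_eq_gaussianReal (P := P) (X := fun q : m × n => X q.1 q.2)
    (fun q => hm q.1 q.2) hX (fun q => hlaw q.1 q.2) c hw2'
  have h2 : charFun (P.map fun ω => toLp 2 fun i => ∑ j, X i j ω * g j) t =
      charFun (P.map fun ω => ∑ q, c q * X q.1 q.2 ω) 1 := by
    rw [charFun_apply, charFun_apply, integral_map (by fun_prop) (by fun_prop),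
      integral_map (by fun_prop) (by fun_prop)]
    congr 1
    ext ω
    congr 3
    simp only [PiLp.inner_apply, RCLike.inner_apply, conj_trivial, one_mul, Finset.mul_sum]
    rw [Fintype.sum_prod_type]
    exact Finset.sum_congr rfl fun i _ => Finset.sum_congr rfl fun j _ => by simp only [c]; ring
  rw [h2, h1, charFun_gaussianReal]
  simp only [charFun_gaussianReal]
  rw [← Complex.exp_sum]
  congr 1
  have e : (w2 : ℝ) = ∑ i, w * t i ^ 2 := by
    rw [hw2', Fintype.sum_prod_type, ← Finset.mul_sum, hw', mul_assoc, Finset.sum_mul_sum,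
      Finset.sum_comm]
    simp only [c, mul_pow]
    congr 1
    exact Finset.sum_congr rfl fun i _ => Finset.sum_congr rfl fun j _ => by ring
  have e' := congrArg (fun x : ℝ => (x : ℂ)) e
  push_cast at e'
  rw [e']
  simp [Finset.sum_div]

lemma lintegral_exp_norm_sq_mulVec_le {X : m → n → Ω → ℝ} {v : ℝ≥0} (hv : 0 < v)
    (hm : ∀ i j, Measurable (X i j)) (hX : iIndepFun (fun q : m × n => X q.1 q.2) P)
    (hlaw : ∀ i j, P.map (X i j) = gaussianReal 0 v) {g : EuclideanSpace ℝ n} (hg : ‖g‖ ≤ 1) :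
    ∫⁻ ω, ENNReal.ofReal (Real.exp (3 / (8 * v) * ∑ i, (∑ j, X i j ω * g j) ^ 2)) ∂P ≤
      2 ^ Fintype.card m := by
  set w : ℝ≥0 := v * ∑ j, (‖g j‖₊) ^ 2 with hw
  have hw' : (w : ℝ) = v * ∑ j, g j ^ 2 := by simp [hw]
  have hwv : w ≤ v := by
    rw [← NNReal.coe_le_coe, hw', ← EuclideanSpace.real_norm_sq_eq]
    exact mul_le_of_le_one_right v.coe_nonneg (pow_le_one₀ (norm_nonneg g) hg)
  have hind := (iIndepFun_sum_row hm hX hlaw g.ofLp).comp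
    (fun _ y => ENNReal.ofReal (Real.exp (3 / (8 * v) * y ^ 2))) fun i => by fun_prop
  have h1 := lintegral_prod_eq_prod_lintegral_of_indepFun Finset.univ _ hind
    fun i => by simp only [Function.comp_def]; fun_prop
  have h2 : ∀ ω, ENNReal.ofReal (Real.exp (3 / (8 * v) * ∑ i, (∑ j, X i j ω * g j) ^ 2)) =
      ∏ i, ENNReal.ofReal (Real.exp (3 / (8 * v) * (∑ j, X i j ω * g j) ^ 2)) := by
    intro ω
    rw [Finset.mul_sum, Real.exp_sum, ENNReal.ofReal_prod_of_nonneg fun i _ => (Real.exp_pos _).le]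
  simp only [h2]
  refine h1.trans_le ?_
  rw [← Finset.card_univ, ← Finset.prod_const]
  refine Finset.prod_le_prod' fun i _ => ?_
  simp only [Function.comp_def]
  rw [← lintegral_map (f := fun y => ENNReal.ofReal (Real.exp (3 / (8 * v) * y ^ 2)))
    (by fun_prop) (by fun_prop), map_sum_row_eq_gaussianReal hm hX hlaw g.ofLp i hw']
  exact lintegral_exp_sq_gaussianReal_le hv hwv

end GaussianMatrix

/-! ### Tail bound for the spectral norm -/

section GaussianMatrixNorm

open scoped ENNReal RealInnerProductSpace Matrix.Norms.L2Operator
open Matrix WithLp Metric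

variable {Ω : Type*} [MeasurableSpace Ω] {P : Measure Ω} [IsProbabilityMeasure P]
variable {m n : Type} [Fintype m] [Fintype n] [DecidableEq m] [DecidableEq n]

lemma measurable_specNorm {X : m → n → Ω → ℝ} (hm : ∀ i j, Measurable (X i j)) :
    Measurable fun ω => specNorm (Matrix.of fun i j => X i j ω) := by
  have hc : Continuous fun M : m → n → ℝ => specNorm (Matrix.of M) := by
    have : Continuous fun M : Matrix m n ℝ => ‖M‖ := continuous_norm
    exact this
  exact hc.measurable.comp (measurable_pi_lambda _ fun i => measurable_pi_lambda _ fun j => hm i j)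

/-- If the spectral norm of `M` exceeds `τ`, then `‖M g‖` is almost `τ` on a small ball inside the
unit ball. -/
lemma exists_closedBall_le_norm_mulVec (M : Matrix m n ℝ) {τ : ℝ} (hτ0 : 0 ≤ τ)
    (hτ : τ < specNorm M) :
    ∃ z : EuclideanSpace ℝ n, closedBall z (1 / 20) ⊆ closedBall 0 1 ∧
      ∀ g ∈ closedBall z (1 / 20), 9 / 10 * τ ≤ ‖toLp 2 (M *ᵥ g.ofLp)‖ := by
  set s := specNorm M with hs
  have hs0 : 0 < s := hτ0.trans_lt hτ
  -- Chosen so that `19/20 * t - s/20 = 9/10 * τ`: the centre is 19/20 of a near-maximizing unit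
  -- vector, and moving by 1/20 costs at most `s/20`.
  set t := s - 18 / 19 * (s - τ) with ht
  have ht0 : 0 ≤ t := by linarith
  obtain ⟨x, hx⟩ : ∃ x : EuclideanSpace ℝ n, t * ‖x‖ < ‖toLp 2 (M *ᵥ x.ofLp)‖ := by
    by_contra! h
    have := specNorm_le_of_forall M ht0 h
    linarith
  have hx0 : 0 < ‖x‖ := by
    by_contra! h
    have h' : x = 0 := norm_le_zero_iff.1 h
    simp [h'] at hx
  set y := ‖x‖⁻¹ • x with hy
  have hy1 : ‖y‖ = 1 := by rw [hy, norm_smul, norm_inv, norm_norm, inv_mul_cancel₀ hx0.ne']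
  have hMy : t ≤ ‖toLp 2 (M *ᵥ y.ofLp)‖ := by
    rw [hy, ofLp_smul, mulVec_smul, toLp_smul, norm_smul, norm_inv, norm_norm,
      ← div_eq_inv_mul, le_div_iff₀ hx0]
    exact hx.le
  have hz : ‖(19 / 20 : ℝ) • y‖ = 19 / 20 := by rw [norm_smul, hy1]; norm_num
  refine ⟨(19 / 20 : ℝ) • y, ?_, fun g hg => ?_⟩
  · refine closedBall_subset_closedBall' ?_
    rw [dist_zero_right, hz]; norm_num
  · rw [mem_closedBall, dist_eq_norm] at hg
    set h := g - (19 / 20 : ℝ) • y with hh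
    have hgh : g.ofLp = (19 / 20 : ℝ) • y.ofLp + h.ofLp := by rw [hh]; simp
    have h1 := norm_toLp_mulVec_le M h
    have h2 : toLp 2 (M *ᵥ g.ofLp) = (19 / 20 : ℝ) • toLp 2 (M *ᵥ y.ofLp) +
        toLp 2 (M *ᵥ h.ofLp) := by
      rw [hgh, mulVec_add, mulVec_smul, toLp_add, toLp_smul]
    have h3 : ‖(19 / 20 : ℝ) • toLp 2 (M *ᵥ y.ofLp)‖ = 19 / 20 * ‖toLp 2 (M *ᵥ y.ofLp)‖ := by
      rw [norm_smul]; norm_num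
    have h4 := norm_sub_le (toLp 2 (M *ᵥ g.ofLp)) (toLp 2 (M *ᵥ h.ofLp))
    rw [h2, add_sub_cancel_right, ← h2, h3] at h4
    have h5 : s * ‖h‖ ≤ s * (1 / 20) := mul_le_mul_of_nonneg_left hg hs0.le
    have h6 : ‖toLp 2 (M *ᵥ h.ofLp)‖ ≤ s * ‖h‖ := h1
    linarith

lemma norm_sq_toLp_mulVec (M : Matrix m n ℝ) (g : EuclideanSpace ℝ n) :
    ‖toLp 2 (M *ᵥ g.ofLp)‖ ^ 2 = ∑ i, (∑ j, M i j * g j) ^ 2 := by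
  rw [EuclideanSpace.real_norm_sq_eq]; rfl

/-- Integrate `exp(3‖Xg‖²/(8v))` over the unit ball in `g` and over the sample space. On the tail
event a ball of relative volume `20⁻ⁿ` already contributes; by Tonelli the total is at most `2 ^ m`
times the volume. -/
lemma measure_specNorm_mul_le {X : m → n → Ω → ℝ} {v : ℝ≥0} (hv : 0 < v)
    (hm : ∀ i j, Measurable (X i j)) (hX : iIndepFun (fun q : m × n => X q.1 q.2) P)
    (hlaw : ∀ i j, P.map (X i j) = gaussianReal 0 v) {τ : ℝ} (hτ : 0 ≤ τ) :
    ENNReal.ofReal ((1 / 20) ^ Fintype.card n * Real.exp (3 / (8 * v) * (9 / 10 * τ) ^ 2)) *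
      P {ω | τ < specNorm (Matrix.of fun i j => X i j ω)} ≤ 2 ^ Fintype.card m := by
  set B := closedBall (0 : EuclideanSpace ℝ n) 1
  set f : Ω → EuclideanSpace ℝ n → ℝ≥0∞ := fun ω g =>
    ENNReal.ofReal (Real.exp (3 / (8 * v) * ∑ i, (∑ j, X i j ω * g j) ^ 2)) with hf
  have hfm : Measurable (Function.uncurry f) := by
    have : Measurable fun q : Ω × EuclideanSpace ℝ n => ∑ i, (∑ j, X i j q.1 * q.2 j) ^ 2 := by
      refine Finset.measurable_sum _ fun i _ => (Finset.measurable_sum _ fun j _ => ?_).pow_const 2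
      exact ((hm i j).comp measurable_fst).mul (by fun_prop)
    exact ((this.const_mul _).exp).ennreal_ofReal
  set A := {ω | τ < specNorm (Matrix.of fun i j => X i j ω)} with hA
  have hAm : MeasurableSet A := measurableSet_lt measurable_const (measurable_specNorm hm)
  set K := ENNReal.ofReal (Real.exp (3 / (8 * v) * (9 / 10 * τ) ^ 2)) with hK
  set c := ENNReal.ofReal ((1 / 20) ^ Fintype.card n)
  have hB0 : volume B ≠ 0 := (measure_closedBall_pos _ _ one_pos).ne'
  have hBt : volume B ≠ ∞ := measure_closedBall_lt_top.ne
  have h1 : ∀ ω ∈ A, c * volume B * K ≤ ∫⁻ g in B, f ω g := by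
    intro ω hω
    obtain ⟨z, hzB, hz⟩ := exists_closedBall_le_norm_mulVec _ hτ hω
    have hvol : volume (closedBall z (1 / 20)) = c * volume B := by
      rw [Measure.addHaar_closedBall' _ _ (by norm_num), finrank_euclideanSpace]
    calc c * volume B * K = ∫⁻ _ in closedBall z (1 / 20), K := by
          rw [setLIntegral_const, hvol, mul_comm]
      _ ≤ ∫⁻ g in closedBall z (1 / 20), f ω g := by
          refine setLIntegral_mono' measurableSet_closedBall fun g hg => ?_
          refine ENNReal.ofReal_le_ofReal (Real.exp_le_exp.2 ?_)
          refine mul_le_mul_of_nonneg_left ?_ (by positivity)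
          have := norm_sq_toLp_mulVec (Matrix.of fun i j => X i j ω) g
          simp only [Matrix.of_apply] at this
          rw [← this]
          exact pow_le_pow_left₀ (by positivity) (hz g hg) 2
      _ ≤ ∫⁻ g in B, f ω g := lintegral_mono_set hzB
  have h2 : c * volume B * K * P A ≤ volume B * 2 ^ Fintype.card m := by
    calc c * volume B * K * P A = ∫⁻ _ in A, c * volume B * K ∂P := by rw [setLIntegral_const]
      _ ≤ ∫⁻ ω in A, (∫⁻ g in B, f ω g) ∂P := setLIntegral_mono' hAm h1
      _ ≤ ∫⁻ ω, (∫⁻ g in B, f ω g) ∂P := setLIntegral_le_lintegral _ _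
      _ = ∫⁻ g in B, ∫⁻ ω, f ω g ∂P := lintegral_lintegral_swap hfm.aemeasurable
      _ ≤ ∫⁻ _ in B, 2 ^ Fintype.card m := by
          refine setLIntegral_mono' measurableSet_closedBall fun g hg => ?_
          exact lintegral_exp_norm_sq_mulVec_le hv hm hX hlaw (by simpa [B] using hg)
      _ = volume B * 2 ^ Fintype.card m := by rw [setLIntegral_const, mul_comm]
  rw [ENNReal.ofReal_mul (by positivity)]
  rw [← ENNReal.mul_le_mul_iff_right hB0 hBt]
  refine le_trans (le_of_eq ?_) h2
  ring

/-- With `b ≤ a` one has `√a √b ≥ b`, so the positive exponent is at least `2.73 a + 8.2 b`, above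
the required `2.7 a + 5.5 b`. The volume factor `20 ^ b` must sit on the smaller dimension; the
other case is handled by transposing. -/
lemma exp_tail_numeric {a b : ℕ} (hba : b ≤ a) :
    (2 : ℝ) ^ a * 20 ^ b ≤ Real.exp (3 / 8 * (9 / 10 * (3 * (√a + √b))) ^ 2) *
      Real.exp (-2 * a - 2 * b) := by
  have h2 : (2 : ℝ) ≤ Real.exp 0.7 := by
    rw [← Real.exp_log (by norm_num : (0 : ℝ) < 2)]
    exact Real.exp_le_exp.2 (by linarith [Real.log_two_lt_d9])
  have h20 : (20 : ℝ) ≤ Real.exp 0.7 ^ 5 :=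
    le_trans (by norm_num) (pow_le_pow_left₀ zero_le_two h2 5)
  have hab : (b : ℝ) ≤ √a * √b := by
    have hle : √(b : ℝ) ≤ √a := Real.sqrt_le_sqrt (by exact_mod_cast hba)
    calc (b : ℝ) = √b * √b := (Real.mul_self_sqrt b.cast_nonneg).symm
      _ ≤ √a * √b := mul_le_mul_of_nonneg_right hle (Real.sqrt_nonneg _)
  calc (2 : ℝ) ^ a * 20 ^ b ≤ Real.exp 0.7 ^ a * (Real.exp 0.7 ^ 5) ^ b :=
        mul_le_mul (pow_le_pow_left₀ zero_le_two h2 a) (pow_le_pow_left₀ (by norm_num) h20 b)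
          (by positivity) (by positivity)
    _ = Real.exp (0.7 * a + 3.5 * b) := by
        rw [← pow_mul, ← Real.exp_nat_mul, ← Real.exp_nat_mul, ← Real.exp_add]
        congr 1; push_cast; ring
    _ ≤ _ := by
        rw [← Real.exp_add]
        refine Real.exp_le_exp.2 ?_
        have e : (9 / 10 * (3 * (√(a : ℝ) + √b))) ^ 2 = 7.29 * (a + b + 2 * (√a * √b)) := by
          rw [mul_pow, mul_pow, add_sq, Real.sq_sqrt a.cast_nonneg, Real.sq_sqrt b.cast_nonneg]
          ring
        rw [e]
        have ha0 : (0 : ℝ) ≤ a := a.cast_nonneg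
        have hb0 : (0 : ℝ) ≤ b := b.cast_nonneg
        linarith

lemma measureReal_specNorm_le_of_card_le {X : m → n → Ω → ℝ} {σ : ℝ≥0} (hσ : 0 < σ)
    (hm : ∀ i j, Measurable (X i j)) (hX : iIndepFun (fun q : m × n => X q.1 q.2) P)
    (hlaw : ∀ i j, P.map (X i j) = gaussianReal 0 (σ ^ 2))
    (hcard : Fintype.card n ≤ Fintype.card m) :
    P.real {ω | 3 * σ * (√(Fintype.card m) + √(Fintype.card n)) <
      specNorm (Matrix.of fun i j => X i j ω)} ≤
      Real.exp (-2 * Fintype.card m - 2 * Fintype.card n) := by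
  set a := Fintype.card m
  set b := Fintype.card n
  have h := measure_specNorm_mul_le (v := σ ^ 2) (pow_pos hσ 2) hm hX hlaw
    (τ := 3 * σ * (√a + √b)) (by positivity)
  have h' := ENNReal.toReal_mono (by simp) h
  rw [ENNReal.toReal_mul, ENNReal.toReal_ofReal (by positivity), ← measureReal_def] at h'
  simp only [ENNReal.toReal_pow, ENNReal.toReal_ofNat] at h'
  have hσ' : (0 : ℝ) < σ := hσ
  have e : 3 / (8 * ((σ ^ 2 : ℝ≥0) : ℝ)) * (9 / 10 * (3 * σ * (√a + √b))) ^ 2 =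
      3 / 8 * (9 / 10 * (3 * (√a + √b))) ^ 2 := by
    push_cast
    field_simp
  rw [e] at h'
  set p := P.real {ω | 3 * σ * (√(a : ℝ) + √b) < specNorm (Matrix.of fun i j => X i j ω)}
  set E := Real.exp (3 / 8 * (9 / 10 * (3 * (√(a : ℝ) + √b))) ^ 2)
  have hE : 0 < E := Real.exp_pos _
  have hnum := exp_tail_numeric hcard
  have h1 : E * p ≤ 2 ^ a * 20 ^ b := by
    have : (20 : ℝ) ^ b * ((1 / 20) ^ b * E * p) ≤ 20 ^ b * 2 ^ a :=
      mul_le_mul_of_nonneg_left h' (by positivity)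
    have h20 : (20 : ℝ) ^ b * (1 / 20) ^ b = 1 := by rw [← mul_pow]; norm_num
    calc E * p = 20 ^ b * (1 / 20) ^ b * (E * p) := by rw [h20, one_mul]
      _ ≤ _ := by linarith
  exact le_of_mul_le_mul_left (h1.trans hnum) hE

/-- Tail bound for the spectral norm of a matrix with i.i.d. centred Gaussian entries. -/
lemma measureReal_specNorm_gaussian_le {X : m → n → Ω → ℝ} {σ : ℝ≥0} (hσ : 0 < σ)
    (hm : ∀ i j, Measurable (X i j)) (hX : iIndepFun (fun q : m × n => X q.1 q.2) P)
    (hlaw : ∀ i j, P.map (X i j) = gaussianReal 0 (σ ^ 2)) :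
    P.real {ω | 3 * σ * (√(Fintype.card m) + √(Fintype.card n)) <
      specNorm (Matrix.of fun i j => X i j ω)} ≤
      Real.exp (-2 * Fintype.card m - 2 * Fintype.card n) := by
  rcases le_total (Fintype.card n) (Fintype.card m) with h | h
  · exact measureReal_specNorm_le_of_card_le hσ hm hX hlaw h
  · have := measureReal_specNorm_le_of_card_le (P := P) (X := fun j i => X i j) hσ
      (fun j i => hm i j)
      (hX.precomp (g := (Prod.swap : n × m → m × n)) Prod.swap_injective) (fun j i => hlaw i j) h
    have e : ∀ ω, specNorm (Matrix.of fun j i => X i j ω) =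
        specNorm (Matrix.of fun i j => X i j ω) := fun ω => by
      rw [← specNorm_transpose]; rfl
    simp only [e] at this
    rw [add_comm √(Fintype.card m : ℝ), show -2 * (Fintype.card m : ℝ) - 2 * Fintype.card n =
      -2 * Fintype.card n - 2 * Fintype.card m by ring]
    exact this

lemma specNorm_zero : specNorm (0 : Matrix m n ℝ) = 0 :=
  le_antisymm (specNorm_le_of_forall _ le_rfl fun x => by simp) (specNorm_nonneg _)

lemma exists_event_specNorm_le {X : m → n → Ω → ℝ} {σ : ℝ≥0}
    (hm : ∀ i j, Measurable (X i j)) (hX : iIndepFun (fun q : m × n => X q.1 q.2) P)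
    (hlaw : ∀ i j, P.map (X i j) = gaussianReal 0 (σ ^ 2)) :
    ∃ E : Set Ω, MeasurableSet E ∧
      1 - Real.exp (-2 * Fintype.card m - 2 * Fintype.card n) ≤ P.real E ∧
      ∀ ω ∈ E, specNorm (Matrix.of fun i j => X i j ω) ≤
        3 * σ * (√(Fintype.card m) + √(Fintype.card n)) := by
  have hA : MeasurableSet {ω | 3 * σ * (√(Fintype.card m) + √(Fintype.card n)) <
      specNorm (Matrix.of fun i j => X i j ω)} :=
    measurableSet_lt measurable_const (measurable_specNorm hm)
  refine ⟨_, hA.compl, ?_, fun ω hω => not_lt.1 hω⟩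
  rw [probReal_compl_eq_one_sub hA]
  refine sub_le_sub_left ?_ 1
  -- For `σ = 0` the density argument is unavailable, but the noise vanishes almost surely.
  rcases eq_zero_or_pos σ with rfl | hσ
  · have h0 : ∀ᵐ ω ∂P, ∀ i j, X i j ω = 0 := by
      refine ae_all_iff.2 fun i => ae_all_iff.2 fun j => ?_
      have h1 : ∀ᵐ y ∂(P.map (X i j)), y = 0 := by
        rw [hlaw, zero_pow two_ne_zero, gaussianReal_zero_var]
        exact (ae_dirac_iff (measurableSet_singleton 0)).2 rfl
      exact ae_of_ae_map (hm i j).aemeasurable h1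
    have : P {ω | 3 * ((0 : ℝ≥0) : ℝ) * (√(Fintype.card m) + √(Fintype.card n)) <
        specNorm (Matrix.of fun i j => X i j ω)} = 0 := by
      refine measure_mono_null (fun ω hω => ?_) (ae_iff.1 h0)
      intro h
      have hz : (Matrix.of fun i j => X i j ω) = 0 := by ext i j; exact h i j
      simp [hz, specNorm_zero] at hω
    rw [measureReal_def, this]
    exact (Real.exp_pos _).le
  · exact measureReal_specNorm_gaussian_le hσ hm hX hlaw

end GaussianMatrixNorm

/-! ### Eigengap -/

section Eigengap

variable {r : ℕ} [NeZero r] {lam : Fin r → ℝ}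

lemma extLam_succ (lam : Fin r → ℝ) (j : Fin r) : extLam lam (j + 1) = lam j := by
  simp [extLam]

lemma extLam_add_two_le (hlam : StrictAnti lam) {i j : Fin r}
    (h : j < i) : lam i ≤ extLam lam (j + 2) := by
  have hj : (j : ℕ) + 1 < r := lt_of_le_of_lt (Nat.succ_le_of_lt h) i.2
  rw [extLam, dif_pos hj]
  exact hlam.antitone (Nat.succ_le_of_lt h)

lemma extLam_add_two_nonneg (hpos : ∀ j, 0 < lam j) (j : Fin r) : 0 ≤ extLam lam (j + 2) := by
  rw [extLam]
  split_ifs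
  · exact (hpos _).le
  · exact le_rfl

lemma eigengap_pos (hpos : ∀ j, 0 < lam j) (hlam : StrictAnti lam) (j : Fin r) :
    0 < eigengap lam j := by
  refine lt_min ?_ ?_
  · rw [extLam_succ, sub_pos]
    obtain ⟨j, hj⟩ := j
    rcases j with _ | k
    · show lam 0 < 2 * lam 0
      linarith [hpos 0]
    · simp only [extLam]
      rw [dif_pos (by omega)]
      exact hlam (Nat.lt_succ_self k)
  · rw [extLam_succ, sub_pos, extLam]
    split_ifs with h
    · exact hlam (Nat.lt_succ_self j)
    · exact hpos j

lemma eigengap_le (hpos : ∀ j, 0 < lam j) (j : Fin r) : eigengap lam j ≤ lam j := by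
  refine (min_le_right _ _).trans ?_
  rw [extLam_succ]
  linarith [extLam_add_two_nonneg hpos j]

lemma eigengap_le_abs_sub (hlam : StrictAnti lam) (j i : Fin r)
    (hij : i ≠ j) : eigengap lam j ≤ |lam i - lam j| := by
  rcases lt_or_gt_of_ne hij with h | h
  · refine (min_le_left _ _).trans ?_
    rw [extLam_succ]
    refine le_trans ?_ (le_abs_self _)
    obtain ⟨j, hj⟩ := j
    rcases j with _ | k
    · exact absurd h (Nat.not_lt_zero _)
    · simp only [extLam]
      rw [dif_pos (by omega)]
      have : lam ⟨k, by omega⟩ ≤ lam i := hlam.antitone (Nat.le_of_lt_succ h)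
      linarith
  · refine (min_le_right _ _).trans ?_
    rw [extLam_succ, abs_sub_comm]
    refine le_trans ?_ (le_abs_self _)
    linarith [extLam_add_two_le hlam h]

end Eigengap

/-! ### From the unfolding to the output of CPCA -/

section Unfolding

open scoped RealInnerProductSpace
open Matrix WithLp

variable {N r : ℕ} {d : Fin N → ℕ}

lemma prod_mem_mul_prod_notMem (S : Finset (Fin N)) (f : Fin N → ℝ) :
    (∏ k : {k : Fin N // k ∈ S}, f k) * ∏ k : {k : Fin N // k ∉ S}, f k = ∏ k, f k := by
  convert Fintype.prod_subtype_mul_prod_subtype (fun k => k ∈ S) f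

lemma matUnfold_signal (lam : Fin r → ℝ) (a : Fin r → ∀ k : Fin N, EuclideanSpace ℝ (Fin (d k)))
    (S : Finset (Fin N)) :
    matUnfold S (signal lam a) = basisIn a S * diagonal lam * (basisOut a S)ᵀ := by
  ext x y
  rw [Matrix.mul_apply]
  simp only [matUnfold, signal, mul_diagonal, transpose_apply, basisIn, basisOut]
  refine Finset.sum_congr rfl fun j _ => ?_
  rw [← prod_mem_mul_prod_notMem S]
  have h1 : ∀ k : {k : Fin N // k ∈ S},
      (Equiv.piEquivPiSubtypeProd (fun k => k ∈ S) (fun k => Fin (d k))).symm (x, y) k = x k :=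
    fun k => by simp [Equiv.piEquivPiSubtypeProd, k.2]
  have h2 : ∀ k : {k : Fin N // k ∉ S},
      (Equiv.piEquivPiSubtypeProd (fun k => k ∈ S) (fun k => Fin (d k))).symm (x, y) k = y k :=
    fun k => by simp [Equiv.piEquivPiSubtypeProd, k.2]
  simp only [h1, h2]
  ring

lemma card_idxIn (d : Fin N → ℕ) (S : Finset (Fin N)) :
    (Fintype.card (IdxIn d S) : ℝ) = ∏ k ∈ S, (d k : ℝ) := by
  rw [Fintype.card_pi]
  simp only [Fintype.card_fin]
  push_cast
  exact Finset.prod_coe_sort S fun k => (d k : ℝ)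

lemma card_idxIn_mul_card_idxOut (d : Fin N → ℕ) (S : Finset (Fin N)) :
    (Fintype.card (IdxIn d S) : ℝ) * Fintype.card (IdxOut d S) = ∏ k, (d k : ℝ) := by
  rw [Fintype.card_pi, Fintype.card_pi]
  simp only [Fintype.card_fin]
  push_cast
  exact prod_mem_mul_prod_notMem S fun k => (d k : ℝ)

/-- If a unit tensor is close enough to `⊗ k, a k`, so are the top left singular vectors of its
unfoldings to the factors. -/
lemma specNorm_outer_sub_le_of_rankOne {ι : Type} [Fintype ι] [DecidableEq ι] {d : ι → ℕ}
    {u : EuclideanSpace ℝ (Idx d)} (hu : ‖u‖ = 1)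
    {a : ∀ k, EuclideanSpace ℝ (Fin (d k))} (ha : ∀ k, ‖a k‖ = 1) (k : ι)
    {x : EuclideanSpace ℝ (Fin (d k))}
    (hx : IsTopLeftSingularVector (modeUnfold k u.ofLp) x) {R : ℝ} (hR0 : 0 ≤ R)
    (h : R < 1 → 1 - ⟪u, rankOne a⟫ ^ 2 ≤ R ^ 2 / 2) :
    specNorm (outer x x - outer (a k) (a k)) ≤ R := by
  refine (specNorm_outer_sub_outer_le hx.1 (ha k)).trans ?_
  rcases lt_or_ge R 1 with hR | hR
  · have h1 := h hR
    have h2 : R ^ 2 < 1 := pow_lt_one₀ hR0 hR two_ne_zero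
    have h3 := sq_inner_rankOne_le hu ha k hx (by linarith)
    refine Real.sqrt_le_iff.2 ⟨hR0, ?_⟩
    linarith [sq_nonneg R]
  · refine (Real.sqrt_le_one.2 ?_).trans hR
    linarith [sq_nonneg ⟪x, a k⟫]

theorem specNorm_outer_sub_le_of_isCPCAOutput [NeZero r] {lam : Fin r → ℝ}
    (hpos : ∀ j, 0 < lam j) (hlam : StrictAnti lam)
    {a : Fin r → ∀ k : Fin N, EuclideanSpace ℝ (Fin (d k))} (ha : ∀ j k, ‖a j k‖ = 1)
    {Ψ : Idx d → ℝ} {S : Finset (Fin N)} {ψ : ℝ} (hψ : specNorm (matUnfold S Ψ) ≤ ψ)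
    {lamHat : Fin r → ℝ} {aHat : Fin r → ∀ k : Fin N, EuclideanSpace ℝ (Fin (d k))}
    (hout : IsCPCAOutput (fun x => signal lam a x + Ψ x) S lamHat aHat) (j : Fin r) (k : Fin N) :
    specNorm (outer (aHat j k) (aHat j k) - outer (a j k) (a j k)) ≤
      (1 + 2 * √2 * lam 0 / eigengap lam j) * coherence a S + 2 * ψ / eigengap lam j := by
  obtain ⟨hr, s, u, v, hsvd, hj⟩ := hout
  obtain ⟨-, hin, hnot⟩ := hj j
  have hγ := eigengap_pos hpos hlam j
  have hψ0 : 0 ≤ ψ := (specNorm_nonneg _).trans hψ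
  have hδ0 : 0 ≤ coherence a S := le_max_of_le_left (specNorm_nonneg _)
  have hR0 : 0 ≤ (1 + 2 * √2 * lam 0 / eigengap lam j) * coherence a S
      + 2 * ψ / eigengap lam j := by
    have := hpos 0
    positivity
  have hL : ∀ i, lam i ≤ lam 0 := fun i => hlam.antitone (Fin.zero_le i)
  set T := matUnfold S (fun x => signal lam a x + Ψ x) with hT
  have hsub : T - basisIn a S * diagonal lam * (basisOut a S)ᵀ = matUnfold S Ψ := by
    rw [← matUnfold_signal, hT]
    ext x y
    simp [matUnfold]
  have hM : specNorm (T - basisIn a S * diagonal lam * (basisOut a S)ᵀ) ≤ ψ := by rwa [hsub]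
  have hMt : specNorm (Tᵀ - basisOut a S * diagonal lam * (basisIn a S)ᵀ) ≤ ψ := by
    rw [← specNorm_transpose]
    simpa [Matrix.mul_assoc] using hM
  by_cases hk : k ∈ S
  · have hai : ∀ l : {k : Fin N // k ∈ S}, ‖a j l‖ = 1 := fun l => ha j l
    refine specNorm_outer_sub_le_of_rankOne (hsvd.orthonormal_left.1 _) hai ⟨k, hk⟩ (hin k hk) hR0
      fun hR => ?_
    exact one_sub_sq_inner_colVec_le hsvd.eq_sum hsvd.nonneg hsvd.antitone hsvd.orthonormal_left
      hsvd.orthonormal_right (fun i => (hpos i).le) hlam.antitone hL (le_max_left _ _)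
      (le_max_right _ _) hM j hr hγ (eigengap_le_abs_sub hlam j)
      (eigengap_le hpos j) (norm_rankOne hai) hR
  -- Modes outside `S` are the same argument for the transposed matrix, with the roles of the two
  -- bases exchanged.
  · have hai : ∀ l : {k : Fin N // k ∉ S}, ‖a j l‖ = 1 := fun l => ha j l
    refine specNorm_outer_sub_le_of_rankOne (hsvd.orthonormal_right.1 _) hai ⟨k, hk⟩ (hnot k hk)
      hR0 fun hR => ?_
    exact one_sub_sq_inner_colVec_le (transpose_eq_sum_outer hsvd.eq_sum) hsvd.nonneg
      hsvd.antitone hsvd.orthonormal_right hsvd.orthonormal_left (fun i => (hpos i).le)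
      hlam.antitone hL (le_max_right _ _) (le_max_left _ _)
      hMt j hr hγ
      (eigengap_le_abs_sub hlam j) (eigengap_le hpos j) (norm_rankOne hai) hR

end Unfolding

end CPModel

theorem mainTheorem5 {N r : ℕ} [NeZero r] (d : Fin N → ℕ)
    (lam : Fin r → ℝ) (hlam_pos : ∀ j, 0 < lam j) (hlam : StrictAnti lam)
    (a : Fin r → ∀ k : Fin N, EuclideanSpace ℝ (Fin (d k))) (ha : ∀ j k, ‖a j k‖ = 1)
    (σ : ℝ≥0) {Ω : Type*} [MeasurableSpace Ω] (P : Measure Ω) [IsProbabilityMeasure P]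
    (Ψ : Ω → CPModel.Idx d → ℝ)
    (hΨ_meas : ∀ x, Measurable fun ω => Ψ ω x)
    (hΨ_indep : iIndepFun (fun x ω => Ψ ω x) P)
    (hΨ_law : ∀ x, P.map (fun ω => Ψ ω x) = gaussianReal 0 (σ ^ 2))
    (S : Finset (Fin N)) (d_all d_S : ℝ)
    (hd_all : d_all = ∏ k, (d k : ℝ)) (hd_S : d_S = ∏ k ∈ S, (d k : ℝ)) :
    ∃ E : Set Ω, MeasurableSet E ∧
      1 - Real.exp (-2 * d_S - 2 * (d_all / d_S)) ≤ P.real E ∧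
      ∀ ω ∈ E, ∀ (lamHat : Fin r → ℝ)
        (aHat : Fin r → ∀ k : Fin N, EuclideanSpace ℝ (Fin (d k))),
        CPModel.IsCPCAOutput (fun x => CPModel.signal lam a x + Ψ ω x) S lamHat aHat →
        ∀ (j : Fin r) (k : Fin N),
          CPModel.specNorm
              (CPModel.outer (aHat j k) (aHat j k) - CPModel.outer (a j k) (a j k)) ≤
            (1 + 2 * √2 * lam 0 / CPModel.eigengap lam j) * CPModel.coherence a S +
              6 * σ * (√d_S + √(d_all / d_S)) / CPModel.eigengap lam j := by
  -- Positivity of the dimensions comes from the existence of unit vectors `a 0 k`; it makes the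
  -- quotient `d_all / d_S` the true column count.
  have hd0 : ∀ k, d k ≠ 0 := fun k h => by
    have h1 := EuclideanSpace.real_norm_sq_eq (a 0 k)
    have : IsEmpty (Fin (d k)) := by rw [h]; infer_instance
    rw [ha 0 k, Finset.univ_eq_empty, Finset.sum_empty] at h1
    norm_num at h1
  have hcS : (Fintype.card (CPModel.IdxIn d S) : ℝ) = d_S := by rw [hd_S, CPModel.card_idxIn]
  have hdS0 : d_S ≠ 0 := by
    rw [hd_S]
    exact Finset.prod_ne_zero_iff.2 fun k _ => Nat.cast_ne_zero.2 (hd0 k)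
  have hcSc : (Fintype.card (CPModel.IdxOut d S) : ℝ) = d_all / d_S := by
    rw [eq_div_iff hdS0, mul_comm, ← hcS, CPModel.card_idxIn_mul_card_idxOut, hd_all]
  let e := Equiv.piEquivPiSubtypeProd (fun k => k ∈ S) (fun k => Fin (d k))
  obtain ⟨E, hE, hPE, hbound⟩ := CPModel.exists_event_specNorm_le (P := P) (σ := σ)
    (X := fun x y ω => Ψ ω (e.symm (x, y))) (fun x y => hΨ_meas _)
    (hΨ_indep.precomp (g := fun q => e.symm q) e.symm.injective) (fun x y => hΨ_law _)
  rw [hcS, hcSc] at hPE hbound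
  refine ⟨E, hE, hPE, fun ω hω lamHat aHat hout j k => ?_⟩
  refine (CPModel.specNorm_outer_sub_le_of_isCPCAOutput hlam_pos hlam ha (hbound ω hω) hout j
    k).trans (le_of_eq ?_)
  ring
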